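/- Let $b_\llcorner,b_\ast\in\mathbb R$ with $b_\llcorner-b_\ast\notin 2\pi\mathbb Z$. For a magnetic field $B:\mathbb Z^2\to\mathbb R$ let $$A_B(n,n-e_1)=\delta_{n_2>0}\sum_{m=1}^{n_2}B(n_1,m)-\delta_{n_2<0}\sum_{m=0}^{|n_2|-1}B(n_1,-m),\qquad A_B(n,n-e_2)=0,$$ let $\mathfrak s_{B,j}$ ($j=1,2$) be the magnetic translations $(\mathfrak s_{B,j}\psi)(n)=e^{\mathrm i A_B(n,n-e_j)}\psi(n-e_j)$ on $\ell^2(\mathbb Z^2)$, and let $\mathfrak A_B=C^*(\mathfrak s_{B,1},\mathfrak s_{B,2})\subset\mathcal B(\ell^2(\mathbb Z^2))$. Denote by - $\mathfrak A$ the algebra $\mathfrak A_B$ of the quarter-plane field $B(n)=b_\ast$ if $n_1\le 0$ or $n_2\le 0$, and $B(n)=b_\llcorner$ otherwise; - $\mathfrak A_{\mathtt U}$ the algebra of the field equal to $b_\ast$ for $n_1\le0$ and to $b_\llcorner$ for $n_1>0$; - $\mathfrak A_{\mathtt R}$ the algebra of the field equal to $b_\ast$ for $n_2\le 0$ and to $b_\llcorner$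 for $n_2>0$; - $\mathfrak A_{b_\llcorner}$, $\mathfrak A_{b_\ast}$ the algebras of the constant fields $b_\llcorner$ and $b_\ast$. An evaluation homomorphism is a surjective $*$-homomorphism that sends the $j$-th magnetic translation to the $j$-th magnetic translation for $j=1,2$ (to the pair of $j$-th magnetic translations, if the target is $\mathfrak A_{b_\llcorner}\oplus\mathfrak A_{b_\ast}$); it is unique if it exists. Then there are evaluation homomorphisms $\mathrm{ev}_{\mathtt U}:\mathfrak A\to\mathfrak A_{\mathtt U}$, $\mathrm{ev}_{\mathtt R}:\mathfrak A\to\mathfrak A_{\mathtt R}$, $\mathrm{ev}_{\mathtt U,b}:\mathfrak A_{\mathtt U}\to\mathfrak A_{b_\llcorner}\oplus\mathfrak A_{b_\ast}$ and $\mathrm{ev}_{\mathtt R,b}:\mathfrak A_{\mathtt R}\to\mathfrak A_{b_\llcorner}\oplus\mathfrak A_{b_\ast}$. With the pullback $$\mathfrak A_{\mathtt U,\mathtt R}=\{(\mathfrak u,\mathfrak r)\in\mathfrak A_{\mathtt U}\oplus\mathfrak A_{\mathtt R}\mid \mathrm{ev}_{\mathtt U,b}(\mathfrak u)=\mathrm{ev}_{\mathtt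 R,b}(\mathfrak r)\},$$ the formula $\gamma(\mathfrak a)=(\mathrm{ev}_{\mathtt U}(\mathfrak a),\mathrm{ev}_{\mathtt R}(\mathfrak a))$ defines a $*$-homomorphism $\gamma:\mathfrak A\to\mathfrak A_{\mathtt U,\mathtt R}$, the $C^*$-algebra $\mathcal K$ of compact operators on $\ell^2(\mathbb Z^2)$ is contained in $\mathfrak A$, and the sequence $$0\longrightarrow\mathcal K\overset{i}{\longrightarrow}\mathfrak A\overset{\gamma}{\longrightarrow}\mathfrak A_{\mathtt U,\mathtt R}\longrightarrow0,$$ where $i$ is the inclusion, is exact. Moreover, the projections $\mathfrak r_0$ and $\mathfrak u_0$ of $\ell^2(\mathbb Z^2)$ onto the functions supported in $\{(j,0)\mid j\ge0\}$ and in $\{(0,j)\mid j\ge0\}$, respectively, belong to $\mathfrak A$, and $\mathcal K=\mathfrak A(\mathfrak r_0)\cap\mathfrak A(\mathfrak u_0)$, where $\mathfrak A(\mathfrak x)$ is the closed two-sided ideal of $\mathfrak A$ generated by $\mathfrak x$. -/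

import Mathlib

open scoped ENNReal

namespace MagneticQuarterPlane

noncomputable section

/-- The lattice `ℤ²`. -/
abbrev Lattice : Type := ℤ × ℤ

/-- The Hilbert space `ℓ²(ℤ²)`. -/
abbrev L2 : Type := lp (fun _ : Lattice => ℂ) 2

/-- The `C*`-algebra of bounded operators on `ℓ²(ℤ²)`. -/
abbrev BoundedOp : Type := L2 →L[ℂ] L2

lemma two_toReal_pos : 0 < (2 : ℝ≥0∞).toReal := by norm_num

lemma memℓp_shift (v : Lattice) (ψ : L2) :
    Memℓp (fun n : Lattice => (ψ (n - v) : ℂ)) 2 := by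
  have h := (memℓp_gen_iff two_toReal_pos).1 ψ.2
  exact (memℓp_gen_iff two_toReal_pos).2 ((Equiv.subRight v).summable_iff.2 h)

/-- The (non-magnetic) translation by `v`: `(T_v ψ)(n) = ψ(n - v)`. -/
def translation (v : Lattice) : BoundedOp :=
  LinearMap.mkContinuous
    { toFun := fun ψ => ⟨fun n => ψ (n - v), memℓp_shift v ψ⟩
      map_add' := fun _ _ => rfl
      map_smul' := fun _ _ => rfl } 1 (by
    intro ψ
    rw [one_mul]
    refine lp.norm_le_of_tsum_le two_toReal_pos (norm_nonneg _) ?_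
    rw [lp.norm_rpow_eq_tsum two_toReal_pos]
    exact ((Equiv.subRight v).tsum_eq
      (fun n : Lattice => ‖(ψ n : ℂ)‖ ^ (2 : ℝ≥0∞).toReal)).le)

@[simp] lemma translation_apply (v : Lattice) (ψ : L2) (n : Lattice) :
    (translation v ψ) n = ψ (n - v) := rfl

lemma rpow_mul_le {g : Lattice → ℂ} {C : ℝ} (hC : ∀ n, ‖g n‖ ≤ C) (ψ : L2) (n : Lattice) :
    ‖g n * ψ n‖ ^ (2 : ℝ≥0∞).toReal
      ≤ C ^ (2 : ℝ≥0∞).toReal * ‖(ψ n : ℂ)‖ ^ (2 : ℝ≥0∞).toReal := by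
  have h0 : 0 ≤ C := (norm_nonneg _).trans (hC n)
  rw [norm_mul, ← Real.mul_rpow h0 (norm_nonneg _)]
  exact Real.rpow_le_rpow (by positivity)
    (mul_le_mul_of_nonneg_right (hC n) (norm_nonneg _)) two_toReal_pos.le

lemma memℓp_mul {g : Lattice → ℂ} {C : ℝ} (hC : ∀ n, ‖g n‖ ≤ C) (ψ : L2) :
    Memℓp (fun n : Lattice => g n * (ψ n : ℂ)) 2 := by
  have h := (memℓp_gen_iff two_toReal_pos).1 ψ.2
  exact (memℓp_gen_iff two_toReal_pos).2
    (Summable.of_nonneg_of_le (fun _ => by positivity) (rpow_mul_le hC ψ) (h.mul_left _))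

/-- The multiplication operator `(𝔪_g ψ)(n) = g(n) ψ(n)` of a bounded function `g`;
`C` is any bound of `g` and does not enter the values of the operator. -/
def mulOp (g : Lattice → ℂ) (C : ℝ) (hC : ∀ n, ‖g n‖ ≤ C) : BoundedOp :=
  LinearMap.mkContinuous
    { toFun := fun ψ => ⟨fun n => g n * ψ n, memℓp_mul hC ψ⟩
      map_add' := fun _ _ => by ext n; exact mul_add _ _ _
      map_smul' := fun _ _ => by ext n; exact mul_left_comm _ _ _ } C (by
    intro ψ
    have h0 : 0 ≤ C := (norm_nonneg _).trans (hC 0)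
    refine lp.norm_le_of_tsum_le two_toReal_pos (by positivity) ?_
    have h := (memℓp_gen_iff two_toReal_pos).1 ψ.2
    rw [Real.mul_rpow h0 (norm_nonneg _), lp.norm_rpow_eq_tsum two_toReal_pos, ← tsum_mul_left]
    exact Summable.tsum_le_tsum (rpow_mul_le hC ψ)
      (Summable.of_nonneg_of_le (fun _ => by positivity) (rpow_mul_le hC ψ) (h.mul_left _))
      (h.mul_left _))

@[simp] lemma mulOp_apply (g : Lattice → ℂ) (C : ℝ) (hC : ∀ n, ‖g n‖ ≤ C) (ψ : L2)
    (n : Lattice) : (mulOp g C hC ψ) n = g n * ψ n := rfl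

/-- The canonical basis `e₁ = (1,0)`, `e₂ = (0,1)` of `ℤ²`, indexed by `0, 1 : Fin 2`. -/
def basisVec (j : Fin 2) : Lattice := if j = 0 then (1, 0) else (0, 1)

/-- The standard vector potential `A_B(n, n - e_j)` of a magnetic field `B : ℤ² → ℝ`. It vanishes
in the direction `e₂`, and its circulation around the unit cells is `B`. -/
def vectorPotential (B : Lattice → ℝ) (n : Lattice) (j : Fin 2) : ℝ :=
  if j = 0 then
    (if 0 < n.2 then ∑ m ∈ Finset.Icc 1 n.2, B (n.1, m) else 0)
      - (if n.2 < 0 then ∑ m ∈ Finset.Icc 0 (|n.2| - 1), B (n.1, -m) else 0)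
  else 0

/-- The magnetic translation `(𝔰_j ψ)(n) = exp(i A_B(n, n - e_j)) ψ(n - e_j)`. -/
def magTranslation (B : Lattice → ℝ) (j : Fin 2) : BoundedOp :=
  mulOp (fun n => Complex.exp (Complex.I * (vectorPotential B n j : ℂ))) 1
      (fun _ => (Complex.norm_exp_I_mul_ofReal _).le)
    * translation (basisVec j)

/-- The magnetic algebra `C*(𝔰₁, 𝔰₂)` of the magnetic field `B`: the closure in operator norm
of the star subalgebra of bounded operators generated by the magnetic translations. -/
def magAlgebra (B : Lattice → ℝ) : StarSubalgebra ℂ BoundedOp :=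
  (StarAlgebra.adjoin ℂ (Set.range (magTranslation B))).topologicalClosure

lemma magTranslation_mem (B : Lattice → ℝ) (j : Fin 2) :
    magTranslation B j ∈ magAlgebra B :=
  StarSubalgebra.le_topologicalClosure _ (StarAlgebra.subset_adjoin ℂ _ ⟨j, rfl⟩)

/-- The magnetic translations as elements of the magnetic algebra. -/
def gen (B : Lattice → ℝ) (j : Fin 2) : magAlgebra B :=
  ⟨magTranslation B j, magTranslation_mem B j⟩

/-- The quarter-plane magnetic field: `bstar` where `n₁ ≤ 0` or `n₂ ≤ 0`, and `bcor` on the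
open quarter-plane. -/
def quarterField (bcor bstar : ℝ) (n : Lattice) : ℝ :=
  if n.1 ≤ 0 ∨ n.2 ≤ 0 then bstar else bcor

/-- The Iwatsuka field seen far up (`n₂ → +∞`) in the quarter-plane system. -/
def upField (bcor bstar : ℝ) (n : Lattice) : ℝ := if n.1 ≤ 0 then bstar else bcor

/-- The Iwatsuka field seen far to the right (`n₁ → +∞`) in the quarter-plane system. -/
def rightField (bcor bstar : ℝ) (n : Lattice) : ℝ := if n.2 ≤ 0 then bstar else bcor

/-- The constant magnetic field. -/
def constField (b : ℝ) (_ : Lattice) : ℝ := b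

/-- The magnetic quarter-plane algebra `𝔄`. -/
abbrev quarterAlgebra (bcor bstar : ℝ) : StarSubalgebra ℂ BoundedOp :=
  magAlgebra (quarterField bcor bstar)

/-- The Iwatsuka algebra `𝔄_U`. -/
abbrev upAlgebra (bcor bstar : ℝ) : StarSubalgebra ℂ BoundedOp :=
  magAlgebra (upField bcor bstar)

/-- The Iwatsuka algebra `𝔄_R`. -/
abbrev rightAlgebra (bcor bstar : ℝ) : StarSubalgebra ℂ BoundedOp :=
  magAlgebra (rightField bcor bstar)

/-- The bulk algebra, the direct sum of the magnetic algebras of the two constant fields. -/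
abbrev BulkAlgebra (bcor bstar : ℝ) : Type :=
  magAlgebra (constField bcor) × magAlgebra (constField bstar)

/-- An evaluation homomorphism between magnetic algebras: a surjective `*`-homomorphism which
sends the magnetic translations to the magnetic translations. -/
def IsEvaluation {B B' : Lattice → ℝ} (ev : magAlgebra B →⋆ₐ[ℂ] magAlgebra B') : Prop :=
  Function.Surjective ev ∧ ∀ j, ev (gen B j) = gen B' j

/-- An evaluation homomorphism onto the bulk algebra. -/
def IsBulkEvaluation {B : Lattice → ℝ} {bcor bstar : ℝ}
    (ev : magAlgebra B →⋆ₐ[ℂ] BulkAlgebra bcor bstar) : Prop :=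
  Function.Surjective ev ∧ ∀ j, ev (gen B j) = (gen (constField bcor) j, gen (constField bstar) j)

/-- The asymptotic algebra: the pullback `{(u, r) ∈ 𝔄_U ⊕ 𝔄_R | ev_{U,b}(u) = ev_{R,b}(r)}` of
two `*`-homomorphisms into the bulk algebra. -/
def asymptoticAlgebra {bcor bstar : ℝ}
    (evUb : upAlgebra bcor bstar →⋆ₐ[ℂ] BulkAlgebra bcor bstar)
    (evRb : rightAlgebra bcor bstar →⋆ₐ[ℂ] BulkAlgebra bcor bstar) :
    StarSubalgebra ℂ (upAlgebra bcor bstar × rightAlgebra bcor bstar) :=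
  StarAlgHom.equalizer
    (evUb.comp (StarAlgHom.fst ℂ (upAlgebra bcor bstar) (rightAlgebra bcor bstar)))
    (evRb.comp (StarAlgHom.snd ℂ (upAlgebra bcor bstar) (rightAlgebra bcor bstar)))

lemma norm_indicator_one_le (S : Set Lattice) (n : Lattice) :
    ‖S.indicator (fun _ => (1 : ℂ)) n‖ ≤ 1 := by
  by_cases h : n ∈ S <;> simp [h]

/-- The projection `𝔪_{χ_S}` onto the functions supported in `S ⊆ ℤ²`. -/
def siteProj (S : Set Lattice) : BoundedOp :=
  mulOp (S.indicator fun _ => 1) 1 (norm_indicator_one_le S)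

/-- `𝔯₀`, the projection onto the right half-line `{j e₁ | j ∈ ℕ}`. -/
def rightProj : BoundedOp := siteProj (Set.range fun j : ℕ => ((j : ℤ), (0 : ℤ)))

/-- `𝔲₀`, the projection onto the up half-line `{j e₂ | j ∈ ℕ}`. -/
def upProj : BoundedOp := siteProj (Set.range fun j : ℕ => ((0 : ℤ), (j : ℤ)))

/-- The closed two-sided ideal generated by `x`. -/
def closedIdeal {A : Type*} [Ring A] [TopologicalSpace A] (x : A) : Set A :=
  closure (TwoSidedIdeal.span {x} : Set A)

lemma isCompactOperator_star {T : BoundedOp} (hT : IsCompactOperator T) :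
    IsCompactOperator (star T : BoundedOp) := by
  have hS : IsCompactOperator (T * star T : BoundedOp) := hT.comp_clm (star T)
  have hc := hS.isCompact_closure_image_ball (f := (T * star T : BoundedOp).toLinearMap) 1
  have htb : TotallyBounded ((T * star T : BoundedOp) '' Metric.ball 0 1) :=
    hc.totallyBounded.subset subset_closure
  refine (isCompactOperator_iff_isCompact_closure_image_ball
    (star T : BoundedOp).toLinearMap one_pos).2 ?_
  refine TotallyBounded.isCompact_of_isClosed (TotallyBounded.closure ?_) isClosed_closure
  rw [Metric.totallyBounded_iff]
  intro ε hε
  obtain ⟨t, hts, htf, hcov⟩ := totallyBounded_iff_subset.1 htb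
    {p | dist p.1 p.2 < ε ^ 2 / 2} (Metric.dist_mem_uniformity (by positivity))
  have hts' : ∀ y ∈ t, ∃ x : L2, x ∈ Metric.ball (0 : L2) 1 ∧ (T * star T : BoundedOp) x = y :=
    fun y hy => hts hy
  choose! f hf hfe using hts'
  refine ⟨(fun y => (star T : BoundedOp) (f y)) '' t, htf.image _, ?_⟩
  rintro _ ⟨x, hx, rfl⟩
  have hx1 := hcov ⟨x, hx, rfl⟩
  simp only [Set.mem_iUnion, Set.mem_ofPred_eq] at hx1
  obtain ⟨y, hy, hxy⟩ := hx1
  simp only [Set.mem_iUnion]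
  refine ⟨_, ⟨y, hy, rfl⟩, ?_⟩
  have hyb := hf y hy
  have hye := hfe y hy
  rw [Metric.mem_ball, dist_eq_norm]
  change ‖(star T : BoundedOp) x - (star T : BoundedOp) (f y)‖ < ε
  rw [← map_sub]
  have h1 : ‖(star T : BoundedOp) (x - f y)‖ ^ 2
      ≤ ‖(T * star T : BoundedOp) (x - f y)‖ * ‖x - f y‖ := by
    have h := ContinuousLinearMap.apply_norm_sq_eq_inner_adjoint_left
      (𝕜 := ℂ) (star T : BoundedOp) (x - f y)
    rw [h]
    have e : ((ContinuousLinearMap.adjoint (star T : BoundedOp)) ∘L (star T : BoundedOp))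
        = (T * star T : BoundedOp) := by
      rw [← ContinuousLinearMap.star_eq_adjoint, star_star]; rfl
    rw [e]
    exact (RCLike.re_le_norm _).trans (norm_inner_le_norm _ _)
  have h2 : ‖(T * star T : BoundedOp) (x - f y)‖ < ε ^ 2 / 2 := by
    rw [map_sub, hye, ← dist_eq_norm]; exact hxy
  have h3 : ‖x - f y‖ < 2 := by
    rw [mem_ball_zero_iff] at hx hyb
    linarith [norm_sub_le x (f y)]
  have h4 : ‖(star T : BoundedOp) (x - f y)‖ ^ 2 < ε ^ 2 := by
    nlinarith [norm_nonneg ((T * star T : BoundedOp) (x - f y)), norm_nonneg (x - f y)]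
  exact lt_of_pow_lt_pow_left₀ 2 hε.le h4

/-- The `C*`-algebra `𝒦` of compact operators on `ℓ²(ℤ²)`. -/
def compactOps : NonUnitalStarSubalgebra ℂ BoundedOp where
  carrier := {T | IsCompactOperator T}
  add_mem' hS hT := IsCompactOperator.add hS hT
  zero_mem' := isCompactOperator_zero
  mul_mem' {S T} hS _ := IsCompactOperator.comp_clm (f := S) hS T
  smul_mem' c _ hT := IsCompactOperator.smul hT c
  star_mem' hT := isCompactOperator_star hT

end

end MagneticQuarterPlane

open MagneticQuarterPlane

/-!
If a field `B` looks like `B'` along a filter of the lattice which is invariant under translations,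
then the pairs of operators which are congruent modulo the operators vanishing along the filter
form a closed algebra, which contains the pairs of magnetic translations. Since `B'` has enough
periods along the filter, no nonzero element of `C*(𝔰_{B'})` vanishes there, so that the closed
algebra generated by the pairs is the graph of an evaluation homomorphism, whose kernel consists of
the elements which vanish along the filter.

An operator is compact if and only if it vanishes along the cofinite filter, that is, in the four
directions of the lattice. Far to the left and far down the quarter-plane field is constant, and
these two limits factor through `ev_U` and `ev_R`. Hence `𝒦 = ker ev_U ∩ ker ev_R = ker γ`.

The commutator `𝔰₁ 𝔰₂ 𝔰₁* 𝔰₂*` is multiplication by `exp(i B)`. As `exp(i b_⌞) ≠ exp(i b_*)`, the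
algebras contain the projections onto the regions where the field is `b_⌞`, hence onto half-lines,
and `𝔄` contains the projection onto a site and with it all of `𝒦`. For the surjectivity of `γ`, an
element `r` of `ker ev_{R,b}` is a norm limit of its restrictions to finitely many rows, and each
row lifts to a half-row, which is invisible to `ev_U`.
-/

namespace MagneticQuarterPlane

noncomputable section

open Filter Topology
open scoped CStarAlgebra

section Generators

variable {R X Y : Type*} [CommSemiring R] [StarRing R] [Semiring X] [StarRing X] [Algebra R X]
  [StarModule R X] [TopologicalSpace X] [IsSemitopologicalSemiring X] [ContinuousStar X]

lemma topologicalClosure_adjoin_le_subalgebra {s : Set X} {S : Subalgebra R X}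
    (hS : IsClosed (S : Set X)) (h : s ⊆ S) (h_star : ∀ x ∈ s, star x ∈ S) :
    (StarAlgebra.adjoin R s).topologicalClosure.toSubalgebra ≤ S := by
  refine closure_minimal (t := (S : Set X)) ?_ hS
  have : (StarAlgebra.adjoin R s).toSubalgebra ≤ S := by
    rw [StarAlgebra.adjoin_toSubalgebra, Algebra.adjoin_le_iff, Set.union_subset_iff]
    exact ⟨h, fun x hx => star_star x ▸ h_star _ hx⟩
  exact this

lemma starAlgHom_ext_of_topologicalClosure_adjoin_eq_top [Semiring Y] [StarRing Y] [Algebra R Y]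
    [TopologicalSpace Y] [T2Space Y] {s : Set X}
    (hs : (StarAlgebra.adjoin R s).topologicalClosure = ⊤) {φ ψ : X →⋆ₐ[R] Y}
    (hφ : Continuous φ) (hψ : Continuous ψ) (h : s.EqOn φ ψ) : φ = ψ := by
  have h_le : (StarAlgebra.adjoin R s).topologicalClosure ≤ StarAlgHom.equalizer φ ψ :=
    StarSubalgebra.topologicalClosure_minimal (StarAlgebra.adjoin_le h) (isClosed_eq hφ hψ)
  rw [hs] at h_le
  exact StarAlgHom.ext fun a => h_le (Set.mem_univ a)

end Generators

lemma map_eq_zero_of_mem_closedIdeal {X Y F : Type*} [Ring X] [TopologicalSpace X] [Ring Y]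
    [TopologicalSpace Y] [T1Space Y] [FunLike F X Y] [RingHomClass F X Y] {φ : F}
    (hφ : Continuous φ) {x a : X} (hx : φ x = 0) (ha : a ∈ closedIdeal x) : φ a = 0 := by
  have h_le : TwoSidedIdeal.span {x} ≤ TwoSidedIdeal.ker φ :=
    TwoSidedIdeal.span_le.2 (Set.singleton_subset_iff.2 ((TwoSidedIdeal.mem_ker φ).2 hx))
  exact closure_minimal (t := φ ⁻¹' {0}) (fun b hb => (TwoSidedIdeal.mem_ker φ).1 (h_le hb))
    (isClosed_singleton.preimage hφ) ha

lemma prod_surjective_of_map_eq_one_of_map_eq_zero {R X Y Z : Type*} [CommSemiring R] [Ring X]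
    [Star X] [Algebra R X] [Ring Y] [Star Y] [Algebra R Y] [Ring Z] [Star Z] [Algebra R Z]
    {φ : X →⋆ₐ[R] Y} {ψ : X →⋆ₐ[R] Z} (hφ : Function.Surjective φ) (hψ : Function.Surjective ψ)
    {x : X} (hφx : φ x = 1) (hψx : ψ x = 0) : Function.Surjective (φ.prod ψ) := by
  rintro ⟨y, z⟩
  obtain ⟨a, rfl⟩ := hφ y
  obtain ⟨b, rfl⟩ := hψ z
  exact ⟨x * a + (1 - x) * b, Prod.ext (by simp [hφx]) (by simp [hψx])⟩

section CStarAlgebra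

variable {X Y : Type*} [CStarAlgebra X] [CStarAlgebra Y]

lemma cfc_star_mul_self_eq_one {g : ℝ → ℝ} {a : X} (hg : ∀ t ≤ ‖a‖ ^ 2, g t = 1) :
    cfc g (star a * a) = 1 := by
  rw [← cfc_const_one ℝ (star a * a)]
  refine cfc_congr fun t ht => hg t ?_
  have : Nontrivial X := (subsingleton_or_nontrivial X).resolve_left fun _ => by simp at ht
  calc t ≤ ‖t‖ := Real.le_norm_self t
    _ ≤ ‖star a * a‖ := spectrum.norm_le_norm_of_mem ht
    _ = ‖a‖ ^ 2 := by rw [CStarRing.norm_star_mul_self, sq]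

lemma norm_mul_cfc_star_mul_self_le {g : ℝ → ℝ} (hg : Continuous g) {r : ℝ} (hr : 0 ≤ r)
    (h : ∀ t, 0 ≤ t → g t ^ 2 * t ≤ r ^ 2) (a : X) : ‖a * cfc g (star a * a)‖ ≤ r := by
  have h_star : star (a * cfc g (star a * a)) * (a * cfc g (star a * a))
      = cfc (fun t => g t * t * g t) (star a * a) := by
    rw [cfc_mul (fun t => g t * t) g _, cfc_mul g (fun t => t) _, cfc_id' ℝ (star a * a),
      star_mul, (cfc_predicate g (star a * a)).star_eq]
    simp only [mul_assoc]
  refine abs_le_of_sq_le_sq' ?_ hr |>.2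
  rw [sq, ← CStarRing.norm_star_mul_self, h_star]
  refine norm_cfc_le (sq_nonneg r) fun t ht => ?_
  have ht0 : 0 ≤ t := spectrum_star_mul_self_nonneg t ht
  rw [Real.norm_of_nonneg (by nlinarith [mul_nonneg (sq_nonneg (g t)) ht0])]
  linarith [h t ht0]

/- Cutting `a` down by the function `t ↦ r / max r √t` of `star a * a`, with `r = ‖φ a‖`,
leaves its image alone, because `star (φ a) * φ a` has spectrum in `[0, r²]`. -/
lemma exists_map_eq_norm_le (φ : X →⋆ₐ[ℂ] Y) (a : X) : ∃ b, φ b = φ a ∧ ‖b‖ ≤ ‖φ a‖ := by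
  obtain hr | hr := (norm_nonneg (φ a)).eq_or_lt
  · exact ⟨0, by rw [map_zero, norm_eq_zero.1 hr.symm], by simp⟩
  set r := ‖φ a‖
  let g : ℝ → ℝ := fun t => r / max r √t
  have hg : Continuous g := by
    refine continuous_const.div (by fun_prop) fun t => (lt_max_of_lt_left hr).ne'
  refine ⟨a * cfc g (star a * a), ?_, norm_mul_cfc_star_mul_self_le hg hr.le (fun t ht => ?_) a⟩
  · have hφ : Continuous φ := map_continuous φ
    rw [map_mul, StarAlgHom.map_cfc φ g (star a * a) hg.continuousOn hφ
      (IsSelfAdjoint.star_mul_self a) ((IsSelfAdjoint.star_mul_self a).map φ), map_mul, map_star,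
      cfc_star_mul_self_eq_one fun t ht => ?_, mul_one]
    have : √t ≤ r := Real.sqrt_le_iff.2 ⟨hr.le, ht⟩
    simp only [g, max_eq_left this, div_self hr.ne']
  · have : 0 < max r √t := lt_max_of_lt_left hr
    rw [div_pow, div_mul_eq_mul_div, div_le_iff₀ (by positivity)]
    gcongr
    calc t = √t ^ 2 := (Real.sq_sqrt ht).symm
      _ ≤ _ := by gcongr; exact le_max_right _ _

lemma isClosed_range_starAlgHom (φ : X →⋆ₐ[ℂ] Y) : IsClosed (Set.range φ) := by
  let f : NormedAddGroupHom X Y :=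
    { toFun := φ
      map_add' := map_add φ
      bound' := ⟨1, fun a => by simpa using NonUnitalStarAlgHom.norm_apply_le φ a⟩ }
  have h_lift : f.SurjectiveOnWith f.range 1 := by
    rintro _ ⟨a, rfl⟩
    obtain ⟨b, hb, hb_norm⟩ := exists_map_eq_norm_le φ a
    exact ⟨b, hb, hb_norm.trans_eq (one_mul _).symm⟩
  refine isClosed_of_closure_subset fun y hy => ?_
  obtain ⟨x, hx, -⟩ := controlled_closure_of_complete one_pos one_pos h_lift y hy
  exact ⟨x, hx⟩

lemma starAlgHom_surjective_of_subset_range (φ : X →⋆ₐ[ℂ] Y) {s : Set Y}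
    (hs : (StarAlgebra.adjoin ℂ s).topologicalClosure = ⊤) (h : s ⊆ Set.range φ) :
    Function.Surjective φ := by
  have h_le : (StarAlgebra.adjoin ℂ s).topologicalClosure ≤ φ.range :=
    StarSubalgebra.topologicalClosure_minimal (StarAlgebra.adjoin_le h)
      (isClosed_range_starAlgHom φ)
  rw [hs] at h_le
  exact fun y => h_le (Set.mem_univ y)

/- The closed `*`-algebra generated by the pairs `(x j, y j)` is the graph of the homomorphism. -/
lemma exists_starAlgHom_of_closed_subalgebra {ι : Type*} {x : ι → X} {y : ι → Y}
    (hx : (StarAlgebra.adjoin ℂ (Set.range x)).topologicalClosure = ⊤)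
    {S : Subalgebra ℂ (X × Y)} (hS : IsClosed (S : Set (X × Y))) (hxy : ∀ j, (x j, y j) ∈ S)
    (hxy_star : ∀ j, (star (x j), star (y j)) ∈ S) (h_zero : ∀ b, ((0 : X), b) ∈ S → b = 0) :
    ∃ φ : X →⋆ₐ[ℂ] Y, ∀ j, φ (x j) = y j := by
  let T := (StarAlgebra.adjoin ℂ (Set.range fun j => (x j, y j))).topologicalClosure
  have hT : IsClosed (T : Set (X × Y)) := StarSubalgebra.isClosed_topologicalClosure _
  have hTS : T.toSubalgebra ≤ S := topologicalClosure_adjoin_le_subalgebra hS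
    (Set.range_subset_iff.2 hxy) (Set.forall_mem_range.2 hxy_star)
  have h_gen (j : ι) : (x j, y j) ∈ T := StarSubalgebra.le_topologicalClosure _
    (StarAlgebra.subset_adjoin ℂ _ ⟨j, rfl⟩)
  let p : T →⋆ₐ[ℂ] X := (StarAlgHom.fst ℂ X Y).comp T.subtype
  have hp_inj : Function.Injective p := by
    refine (injective_iff_map_eq_zero p).2 ?_
    rintro ⟨⟨a, b⟩, hab⟩ (rfl : a = 0)
    exact Subtype.ext (Prod.ext rfl (h_zero b (hTS hab)))
  have hp_surj : Function.Surjective p := starAlgHom_surjective_of_subset_range p hx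
    (Set.range_subset_iff.2 fun j => ⟨⟨_, h_gen j⟩, rfl⟩)
  let e := StarAlgEquiv.ofBijective p ⟨hp_inj, hp_surj⟩
  refine ⟨((StarAlgHom.snd ℂ X Y).comp T.subtype).comp (e.symm : X →⋆ₐ[ℂ] T), fun j => ?_⟩
  have : e.symm (x j) = ⟨_, h_gen j⟩ := (StarAlgEquiv.symm_apply_eq ..).2 rfl
  exact congrArg (fun z : T => z.1.2) this

end CStarAlgebra

lemma isClosed_magAlgebra (B : Lattice → ℝ) : IsClosed (magAlgebra B : Set BoundedOp) :=
  StarSubalgebra.isClosed_topologicalClosure _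

attribute [local instance] isClosed_magAlgebra

section MagneticAlgebra

variable {B B' : Lattice → ℝ}

lemma topologicalClosure_adjoin_gen (B : Lattice → ℝ) :
    (StarAlgebra.adjoin ℂ (Set.range (gen B))).topologicalClosure = ⊤ := by
  set S := (StarAlgebra.adjoin ℂ (Set.range (gen B))).topologicalClosure
  have h_closed : IsClosed (S.map (magAlgebra B).subtype : Set BoundedOp) :=
    (isClosed_magAlgebra B).isClosedEmbedding_subtypeVal.isClosedMap _
      (StarSubalgebra.isClosed_topologicalClosure _)
  have h_le : magAlgebra B ≤ S.map (magAlgebra B).subtype := by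
    refine StarSubalgebra.topologicalClosure_minimal (StarAlgebra.adjoin_le ?_) h_closed
    exact Set.range_subset_iff.2 fun j => ⟨gen B j, StarSubalgebra.le_topologicalClosure _
      (StarAlgebra.subset_adjoin ℂ _ ⟨j, rfl⟩), rfl⟩
  refine eq_top_iff.2 fun a _ => ?_
  obtain ⟨b, hb, hba⟩ := h_le a.2
  rwa [Subtype.ext hba] at hb

lemma IsEvaluation.of_gen {ev : magAlgebra B →⋆ₐ[ℂ] magAlgebra B'}
    (h : ∀ j, ev (gen B j) = gen B' j) : IsEvaluation ev :=
  ⟨starAlgHom_surjective_of_subset_range ev (topologicalClosure_adjoin_gen B')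
    (Set.range_subset_iff.2 fun j => ⟨gen B j, h j⟩), h⟩

lemma IsEvaluation.comp {B'' : Lattice → ℝ} {ev : magAlgebra B →⋆ₐ[ℂ] magAlgebra B'}
    {ev' : magAlgebra B' →⋆ₐ[ℂ] magAlgebra B''} (h : IsEvaluation ev) (h' : IsEvaluation ev') :
    IsEvaluation (ev'.comp ev) :=
  IsEvaluation.of_gen fun j => by rw [StarAlgHom.comp_apply, h.2, h'.2]

lemma bulkEvaluation_comp_eq {B₁ B₂ : Lattice → ℝ} {bcor bstar : ℝ}
    {ev₁ : magAlgebra B →⋆ₐ[ℂ] magAlgebra B₁} {ev₂ : magAlgebra B →⋆ₐ[ℂ] magAlgebra B₂}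
    {evb₁ : magAlgebra B₁ →⋆ₐ[ℂ] BulkAlgebra bcor bstar}
    {evb₂ : magAlgebra B₂ →⋆ₐ[ℂ] BulkAlgebra bcor bstar}
    (h₁ : IsEvaluation ev₁) (h₂ : IsEvaluation ev₂) (hb₁ : IsBulkEvaluation evb₁)
    (hb₂ : IsBulkEvaluation evb₂) : evb₁.comp ev₁ = evb₂.comp ev₂ := by
  refine starAlgHom_ext_of_topologicalClosure_adjoin_eq_top (topologicalClosure_adjoin_gen B)
    (map_continuous _) (map_continuous _) ?_
  rintro _ ⟨j, rfl⟩
  simp only [StarAlgHom.comp_apply, h₁.2, h₂.2, hb₁.2, hb₂.2]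

end MagneticAlgebra

section CanonicalBasis

/-- The vector `δ_n` of the canonical orthonormal basis of `ℓ²(ℤ²)`. -/
def delta (n : Lattice) : L2 := lp.single 2 n 1

lemma delta_apply (n m : Lattice) : delta n m = if m = n then 1 else 0 := by
  simp [delta, Pi.single_apply]

lemma norm_delta (n : Lattice) : ‖delta n‖ = 1 := by
  simp [delta, lp.norm_single]

lemma inner_delta_left (n : Lattice) (ψ : L2) : inner ℂ (delta n) ψ = ψ n := by
  simp [delta, lp.inner_single_left]

lemma hasSum_delta (ψ : L2) : HasSum (fun n => ψ n • delta n) ψ := by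
  simpa [delta, ← lp.single_smul] using lp.hasSum_single (p := 2) (by norm_num) ψ

lemma boundedOp_ext {S T : BoundedOp} (h : ∀ n, S (delta n) = T (delta n)) : S = T := by
  ext1 ψ
  refine ((hasSum_delta ψ).mapL S).unique ?_
  simpa only [map_smul, h] using (hasSum_delta ψ).mapL T

lemma star_apply_delta (T : BoundedOp) (n m : Lattice) :
    (star T) (delta n) m = star (T (delta m) n) := by
  rw [← inner_delta_left m, ContinuousLinearMap.star_eq_adjoint,
    ContinuousLinearMap.adjoint_inner_right, ← inner_conj_symm, inner_delta_left]
  rfl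

lemma mulOp_delta (g : Lattice → ℂ) (C : ℝ) (hC : ∀ n, ‖g n‖ ≤ C) (n : Lattice) :
    mulOp g C hC (delta n) = g n • delta n := by
  ext m
  rw [mulOp_apply, lp.coeFn_smul, Pi.smul_apply, smul_eq_mul, delta_apply]
  split_ifs with h <;> simp [h]

lemma translation_delta (v n : Lattice) : translation v (delta n) = delta (n + v) := by
  ext m
  simp only [translation_apply, delta_apply, sub_eq_iff_eq_add]

end CanonicalBasis

section SiteProj

variable {S T : Set Lattice} {n : Lattice}

lemma siteProj_delta_of_mem (h : n ∈ S) : siteProj S (delta n) = delta n := by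
  rw [siteProj, mulOp_delta, Set.indicator_of_mem h, one_smul]

lemma siteProj_delta_of_notMem (h : n ∉ S) : siteProj S (delta n) = 0 := by
  rw [siteProj, mulOp_delta, Set.indicator_of_notMem h, zero_smul]

lemma star_siteProj (S : Set Lattice) : star (siteProj S) = siteProj S := by
  refine boundedOp_ext fun n => lp.ext (funext fun m => ?_)
  rw [star_apply_delta, siteProj, mulOp_apply, mulOp_apply, delta_apply, delta_apply]
  rcases eq_or_ne m n with rfl | h
  · by_cases hm : m ∈ S <;> simp [hm]
  · simp [h, h.symm]

lemma siteProj_mul (S T : Set Lattice) : siteProj S * siteProj T = siteProj (S ∩ T) := by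
  refine boundedOp_ext fun n => ?_
  rw [mul_apply_eq_comp]
  by_cases hT : n ∈ T <;> by_cases hS : n ∈ S <;>
    simp [siteProj_delta_of_mem, siteProj_delta_of_notMem, hS, hT]

lemma norm_siteProj_le (S : Set Lattice) : ‖siteProj S‖ ≤ 1 :=
  IsStarProjection.norm_le _
    ⟨by rw [IsIdempotentElem, siteProj_mul, Set.inter_self], star_siteProj S⟩

lemma siteProj_univ : siteProj Set.univ = 1 :=
  boundedOp_ext fun n => siteProj_delta_of_mem (Set.mem_univ n)

lemma siteProj_union (h : Disjoint S T) : siteProj (S ∪ T) = siteProj S + siteProj T := by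
  refine boundedOp_ext fun n => ?_
  rw [add_apply]
  by_cases hS : n ∈ S
  · simp [siteProj_delta_of_mem, siteProj_delta_of_notMem, hS, Set.disjoint_left.1 h hS]
  · by_cases hT : n ∈ T <;> simp [siteProj_delta_of_mem, siteProj_delta_of_notMem, hS, hT]

lemma siteProj_diff (h : T ⊆ S) : siteProj (S \ T) = siteProj S - siteProj T := by
  rw [eq_sub_iff_add_eq, ← siteProj_union Set.disjoint_sdiff_left, Set.sdiff_union_of_subset h]

lemma siteProj_singleton (n : Lattice) :
    siteProj {n} = InnerProductSpace.rankOne ℂ (delta n) (delta n) := by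
  refine boundedOp_ext fun m => ?_
  rw [InnerProductSpace.rankOne_apply, inner_delta_left, delta_apply]
  rcases eq_or_ne n m with rfl | h
  · rw [siteProj_delta_of_mem (Set.mem_singleton n), if_pos rfl, one_smul]
  · rw [siteProj_delta_of_notMem (Set.notMem_singleton_iff.2 h.symm), if_neg h, zero_smul]

lemma siteProj_preimage_finset {α : Type*} (f : Lattice → α) (K : Finset α) :
    siteProj (f ⁻¹' K) = ∑ k ∈ K, siteProj (f ⁻¹' {k}) := by
  classical
  refine boundedOp_ext fun n => ?_
  have h (k : α) : siteProj (f ⁻¹' {k}) (delta n) = if f n = k then delta n else 0 := by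
    split_ifs with hk
    · exact siteProj_delta_of_mem hk
    · exact siteProj_delta_of_notMem hk
  rw [sum_apply, Finset.sum_congr rfl fun k _ => h k, Finset.sum_ite_eq]
  split_ifs with hK
  · exact siteProj_delta_of_mem hK
  · exact siteProj_delta_of_notMem hK

end SiteProj

section PhaseTranslation

variable (h h' : Lattice → ℝ) (v v' : Lattice)

/-- The unitary operator `ψ ↦ (n ↦ exp(i h(n)) ψ(n - v))`. The magnetic translations, their
products and adjoints, and the gauge transformations are all of this form. -/
def phaseTranslation : BoundedOp :=
  mulOp (fun n => Complex.exp (Complex.I * h n)) 1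
    (fun _ => (Complex.norm_exp_I_mul_ofReal _).le) * translation v

lemma magTranslation_eq_phaseTranslation (B : Lattice → ℝ) (j : Fin 2) :
    magTranslation B j = phaseTranslation (fun n => vectorPotential B n j) (basisVec j) := rfl

lemma phaseTranslation_delta (n : Lattice) :
    phaseTranslation h v (delta n) = Complex.exp (Complex.I * h (n + v)) • delta (n + v) := by
  rw [phaseTranslation, mul_apply_eq_comp, translation_delta, mulOp_delta]

lemma phaseTranslation_mul :
    phaseTranslation h v * phaseTranslation h' v'
      = phaseTranslation (fun n => h n + h' (n - v)) (v + v') := by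
  refine boundedOp_ext fun n => ?_
  rw [mul_apply_eq_comp]
  simp only [phaseTranslation_delta, map_smul, smul_smul, ← Complex.exp_add]
  congr 2
  · push_cast
    rw [show n + (v + v') - v = n + v' by abel, show n + v' + v = n + (v + v') by abel]
    ring
  · abel

lemma star_phaseTranslation :
    star (phaseTranslation h v) = phaseTranslation (fun n => -h (n + v)) (-v) := by
  refine boundedOp_ext fun n => lp.ext (funext fun m => ?_)
  rw [star_apply_delta, phaseTranslation_delta, phaseTranslation_delta]
  simp only [lp.coeFn_smul, Pi.smul_apply, smul_eq_mul, delta_apply, ← sub_eq_add_neg,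
    sub_add_cancel]
  rcases eq_or_ne m (n - v) with rfl | hm
  · simp [← Complex.exp_conj]
  · rw [if_neg hm, if_neg fun hn => hm (by rw [hn, add_sub_cancel_right])]
    simp

lemma phaseTranslation_zero_zero : phaseTranslation 0 0 = 1 :=
  boundedOp_ext fun n => by simp [phaseTranslation_delta]

lemma phaseTranslation_mem_unitary : phaseTranslation h v ∈ unitary BoundedOp := by
  rw [Unitary.mem_iff, star_phaseTranslation, phaseTranslation_mul, phaseTranslation_mul,
    ← phaseTranslation_zero_zero]
  constructor <;> congr 1 <;> simp [funext_iff]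

lemma phaseTranslation_mul_siteProj (S : Set Lattice) :
    phaseTranslation h v * siteProj S = siteProj ((· + v) '' S) * phaseTranslation h v := by
  refine boundedOp_ext fun n => ?_
  have h_mem : n + v ∈ (· + v) '' S ↔ n ∈ S := (add_left_injective v).mem_set_image
  simp only [mul_apply_eq_comp, phaseTranslation_delta, map_smul]
  by_cases hn : n ∈ S
  · rw [siteProj_delta_of_mem hn, siteProj_delta_of_mem (h_mem.2 hn), phaseTranslation_delta]
  · rw [siteProj_delta_of_notMem hn, siteProj_delta_of_notMem (mt h_mem.1 hn), map_zero, smul_zero]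

lemma phaseTranslation_mul_siteProj_mul_star (S : Set Lattice) :
    phaseTranslation h v * siteProj S * star (phaseTranslation h v) = siteProj ((· + v) '' S) := by
  rw [phaseTranslation_mul_siteProj, mul_assoc,
    Unitary.mul_star_self_of_mem (phaseTranslation_mem_unitary h v), mul_one]

end PhaseTranslation

section VectorPotential

variable {B B' : Lattice → ℝ} {n : Lattice}

lemma vectorPotential_of_nonneg (B : Lattice → ℝ) (hn : 0 ≤ n.2) :
    vectorPotential B n 0 = ∑ m ∈ Finset.Icc 1 n.2, B (n.1, m) := by
  rcases hn.eq_or_lt with hn | hn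
  · simp [vectorPotential, ← hn]
  · simp [vectorPotential, hn, hn.le]

lemma vectorPotential_of_nonpos (B : Lattice → ℝ) (hn : n.2 ≤ 0) :
    vectorPotential B n 0 = -∑ m ∈ Finset.Icc 0 (-n.2 - 1), B (n.1, -m) := by
  rcases hn.eq_or_lt with hn | hn
  · simp [vectorPotential, hn]
  · simp [vectorPotential, hn, hn.le, abs_of_neg]

lemma vectorPotential_one (B : Lattice → ℝ) (n : Lattice) : vectorPotential B n 1 = 0 := rfl

lemma vectorPotential_sub (B : Lattice → ℝ) (a b : ℤ) :
    vectorPotential B (a, b) 0 - vectorPotential B (a, b - 1) 0 = B (a, b) := by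
  rcases le_or_gt b 0 with hb | hb
  · have h_Icc : Finset.Icc 0 (-(b - 1) - 1) = insert (-b) (Finset.Icc 0 (-b - 1)) := by
      rw [Finset.insert_Icc_sub_one_right_eq_Icc (by lia), neg_sub, sub_sub_cancel_left]
    rw [vectorPotential_of_nonpos B hb, vectorPotential_of_nonpos B (by dsimp only; lia), h_Icc,
      Finset.sum_insert (by simp)]
    simp
  · rw [vectorPotential_of_nonneg B hb.le, vectorPotential_of_nonneg B (by dsimp only; lia),
      ← Finset.insert_Icc_sub_one_right_eq_Icc (by lia : 1 ≤ b), Finset.sum_insert (by simp)]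
    simp

lemma vectorPotential_congr (h : ∀ m ∈ Set.uIoc 0 n.2, B (n.1, m) = B' (n.1, m)) :
    vectorPotential B n = vectorPotential B' n := by
  funext j
  fin_cases j
  · rcases le_total 0 n.2 with hn | hn
    · simp only [Set.uIoc_of_le hn, Set.mem_Ioc] at h
      simp only [Fin.zero_eta, vectorPotential_of_nonneg _ hn]
      exact Finset.sum_congr rfl fun m hm => h m (by rw [Finset.mem_Icc] at hm; lia)
    · simp only [Set.uIoc_of_ge hn, Set.mem_Ioc] at h
      simp only [Fin.zero_eta, vectorPotential_of_nonpos _ hn]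
      congr 1
      exact Finset.sum_congr rfl fun m hm => h (-m) (by rw [Finset.mem_Icc] at hm; lia)
  · rfl

/- The vector potential of a field which depends on `n₂` only is an antidifference. -/
lemma exists_sub_sub_one_eq (β : ℤ → ℝ) : ∃ g : ℤ → ℝ, ∀ m, g m - g (m - 1) = β m :=
  ⟨fun m => vectorPotential (fun n => β n.2) (0, m) 0, fun _ => vectorPotential_sub _ _ _⟩

/- A period `v` of the field preserves the circulations of the potential, so that
`vectorPotential B n 0 - vectorPotential B (n - v) 0` depends on `n.1` only, and the gauge `h` is
an antidifference of it. -/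
lemma exists_gauge_of_periodic {v : Lattice} (hB : Function.Periodic B v) :
    ∃ h : Lattice → ℝ, ∀ n j,
      h n + vectorPotential B (n - v) j = vectorPotential B n j + h (n - basisVec j) := by
  let d (a b : ℤ) : ℝ := vectorPotential B (a, b) 0 - vectorPotential B ((a, b) - v) 0
  have h_curl (a b : ℤ) : d a b - d a (b - 1) = 0 := by
    have h₁ := vectorPotential_sub B a b
    have h₂ := vectorPotential_sub B (a - v.1) (b - v.2)
    have h₃ : B (a - v.1, b - v.2) = B (a, b) := hB.sub_eq (a, b)
    rw [sub_right_comm] at h₂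
    change _ - vectorPotential B (a - v.1, b - v.2) 0
      - (_ - vectorPotential B (a - v.1, b - 1 - v.2) 0) = 0
    linarith
  have hd (a b : ℤ) : d a b = d a 0 := by
    have : Function.Periodic (d a) 1 := fun b => by
      simpa [sub_eq_zero] using h_curl a (b + 1)
    simpa using this.int_mul_eq b
  obtain ⟨g, hg⟩ := exists_sub_sub_one_eq fun a => d a 0
  refine ⟨fun n => g n.1, fun n j => ?_⟩
  fin_cases j
  · have := (hg n.1).trans (hd n.1 n.2).symm
    simp only [d, Prod.mk.eta] at this
    simp only [basisVec, Fin.zero_eta, if_true, Prod.fst_sub]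
    linarith
  · simp [vectorPotential, basisVec]

end VectorPotential

section MagneticTranslations

variable {B : Lattice → ℝ}

lemma closure_range_basisVec : AddSubgroup.closure (Set.range basisVec) = ⊤ := by
  refine eq_top_iff.2 fun n _ => ?_
  have h_mem (j : Fin 2) : basisVec j ∈ AddSubgroup.closure (Set.range basisVec) :=
    AddSubgroup.subset_closure ⟨j, rfl⟩
  have hn : n = n.1 • basisVec 0 + n.2 • basisVec 1 := by simp [basisVec]
  rw [hn]
  exact add_mem (zsmul_mem (h_mem 0) _) (zsmul_mem (h_mem 1) _)

lemma exists_phaseTranslation_mem_magAlgebra (B : Lattice → ℝ) (v : Lattice) :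
    ∃ h, phaseTranslation h v ∈ magAlgebra B := by
  have hv : v ∈ AddSubgroup.closure (Set.range basisVec) := closure_range_basisVec ▸ trivial
  induction hv using AddSubgroup.closure_induction with
  | mem _ hv =>
    obtain ⟨j, rfl⟩ := hv
    exact ⟨_, magTranslation_mem B j⟩
  | zero => exact ⟨0, phaseTranslation_zero_zero ▸ one_mem _⟩
  | add v w _ _ hv hw =>
    obtain ⟨g, hg⟩ := hv
    obtain ⟨h, hh⟩ := hw
    exact ⟨_, phaseTranslation_mul g h v w ▸ mul_mem hg hh⟩
  | neg v _ hv =>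
    obtain ⟨g, hg⟩ := hv
    exact ⟨_, star_phaseTranslation g v ▸ star_mem hg⟩

lemma siteProj_image_add_right_mem_magAlgebra {S : Set Lattice} (hS : siteProj S ∈ magAlgebra B)
    (v : Lattice) : siteProj ((· + v) '' S) ∈ magAlgebra B := by
  obtain ⟨h, hh⟩ := exists_phaseTranslation_mem_magAlgebra B v
  exact phaseTranslation_mul_siteProj_mul_star h v S ▸ mul_mem (mul_mem hh hS) (star_mem hh)

/- A period of the field gives, up to a gauge transformation, a translation which commutes with
the whole algebra. -/
lemma norm_apply_delta_add_of_periodic {v : Lattice} (hB : Function.Periodic B v) {a : BoundedOp}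
    (ha : a ∈ magAlgebra B) (n : Lattice) : ‖a (delta (n + v))‖ = ‖a (delta n)‖ := by
  obtain ⟨h, hh⟩ := exists_gauge_of_periodic hB
  set V := phaseTranslation h v
  have hV : V ∈ unitary BoundedOp := phaseTranslation_mem_unitary h v
  have hV_comm (j : Fin 2) : magTranslation B j * V = V * magTranslation B j := by
    simp only [V, magTranslation_eq_phaseTranslation, phaseTranslation_mul, hh, add_comm v]
  have hV_mem : V ∈ StarSubalgebra.centralizer ℂ (Set.range (magTranslation B)) := by
    refine (StarSubalgebra.mem_centralizer_iff ℂ).2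
      (Set.forall_mem_range.2 fun j => ⟨hV_comm j, ?_⟩)
    have hu : magTranslation B j ∈ unitary BoundedOp := phaseTranslation_mem_unitary _ _
    set u := magTranslation B j
    calc star u * V = star u * (V * u) * star u := by
          rw [mul_assoc, mul_assoc, Unitary.mul_star_self_of_mem hu, mul_one]
      _ = V * star u := by
          rw [← hV_comm, ← mul_assoc, Unitary.star_mul_self_of_mem hu, one_mul]
  have h_comm : V * a = a * V :=
    (StarSubalgebra.mem_centralizer_iff ℂ).1
      (StarSubalgebra.topologicalClosure_adjoin_le_centralizer_centralizer ℂ _ ha) V hV_mem |>.1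
  have h_phase : ‖a (V (delta n))‖ = ‖a (delta (n + v))‖ := by
    rw [phaseTranslation_delta, map_smul, norm_smul, Complex.norm_exp_I_mul_ofReal, one_mul]
  rw [← h_phase, ← mul_apply_eq_comp, ← h_comm, mul_apply_eq_comp,
    ContinuousLinearMap.norm_map_of_mem_unitary hV]

end MagneticTranslations

section VanishingIdeal

variable {F G : Filter Lattice} {T : BoundedOp}

/-- The closed left ideal of the bounded operators which vanish, in norm, along the filter `F`
of the lattice: the norm limits of operators which annihilate `δ_n` for all `n` near `F`. The
kernel of an evaluation homomorphism consists of the elements which vanish along a filter. -/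
def vanishingIdeal (F : Filter Lattice) : Ideal BoundedOp :=
  Ideal.closure
    { carrier := {T | ∀ᶠ n in F, T (delta n) = 0}
      add_mem' := fun hS hT => by
        filter_upwards [hS, hT] with n hSn hTn
        rw [add_apply, hSn, hTn, add_zero]
      zero_mem' := Eventually.of_forall fun _ => rfl
      smul_mem' := fun R T hT => hT.mono fun n hn => by
        rw [smul_eq_mul, mul_apply_eq_comp, hn, map_zero] }

lemma isClosed_vanishingIdeal (F : Filter Lattice) : IsClosed (vanishingIdeal F : Set BoundedOp) :=
  isClosed_closure

lemma mem_vanishingIdeal_of_eventually (h : ∀ᶠ n in F, T (delta n) = 0) : T ∈ vanishingIdeal F :=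
  subset_closure h

lemma norm_mul_siteProj_le_of_subset (T : BoundedOp) {S S' : Set Lattice} (h : S' ⊆ S) :
    ‖T * siteProj S'‖ ≤ ‖T * siteProj S‖ := by
  rw [← Set.inter_eq_right.2 h, ← siteProj_mul, ← mul_assoc]
  exact (norm_mul_le _ _).trans (mul_le_of_le_one_right (norm_nonneg _) (norm_siteProj_le S'))

lemma mem_vanishingIdeal_iff :
    T ∈ vanishingIdeal F ↔ ∀ ε > 0, ∃ S ∈ F, ‖T * siteProj S‖ < ε := by
  refine Metric.mem_closure_iff.trans (forall₂_congr fun ε _ => ⟨?_, ?_⟩)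
  · rintro ⟨T', hT', hTT'⟩
    have h_zero : T' * siteProj {n | T' (delta n) = 0} = 0 := boundedOp_ext fun n => by
      by_cases hn : T' (delta n) = 0
      · rw [mul_apply_eq_comp, siteProj_delta_of_mem hn, hn, zero_apply]
      · rw [mul_apply_eq_comp, siteProj_delta_of_notMem hn, map_zero, zero_apply]
    refine ⟨_, hT', ?_⟩
    calc ‖T * siteProj {n | T' (delta n) = 0}‖
        = ‖(T - T') * siteProj {n | T' (delta n) = 0}‖ := by rw [sub_mul, h_zero, sub_zero]
      _ ≤ ‖T - T'‖ :=
        (norm_mul_le _ _).trans (mul_le_of_le_one_right (norm_nonneg _) (norm_siteProj_le _))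
      _ < ε := by rwa [← dist_eq_norm]
  · rintro ⟨S, hS, h_lt⟩
    refine ⟨T - T * siteProj S, mem_of_superset hS fun n hn => ?_, ?_⟩
    · change (T - T * siteProj S) (delta n) = 0
      rw [sub_apply, mul_apply_eq_comp, siteProj_delta_of_mem hn, sub_self]
    · rwa [dist_eq_norm, sub_sub_cancel]

lemma vanishingIdeal_anti (h : F ≤ G) : vanishingIdeal G ≤ vanishingIdeal F := fun T hT => by
  rw [mem_vanishingIdeal_iff] at hT ⊢
  exact fun ε hε => (hT ε hε).imp fun S hS => ⟨h hS.1, hS.2⟩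

lemma vanishingIdeal_sup (F G : Filter Lattice) :
    vanishingIdeal (F ⊔ G) = vanishingIdeal F ⊓ vanishingIdeal G := by
  refine le_antisymm (le_inf (vanishingIdeal_anti le_sup_left) (vanishingIdeal_anti le_sup_right))
    fun T hT => mem_vanishingIdeal_iff.2 fun ε hε => ?_
  obtain ⟨S, hS, hS_lt⟩ := mem_vanishingIdeal_iff.1 hT.1 (ε / 2) (half_pos hε)
  obtain ⟨S', hS', hS'_lt⟩ := mem_vanishingIdeal_iff.1 hT.2 (ε / 2) (half_pos hε)
  refine ⟨S ∪ S', union_mem_sup hS hS', ?_⟩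
  have h_diff := norm_mul_siteProj_le_of_subset T (Set.sdiff_subset : S' \ S ⊆ S')
  calc ‖T * siteProj (S ∪ S')‖ = ‖T * siteProj S + T * siteProj (S' \ S)‖ := by
        rw [← mul_add, ← siteProj_union Set.disjoint_sdiff_right, Set.union_sdiff_self]
    _ ≤ ‖T * siteProj S‖ + ‖T * siteProj (S' \ S)‖ := norm_add_le _ _
    _ < ε := by linarith

lemma tendsto_norm_apply_delta_of_mem_vanishingIdeal (hT : T ∈ vanishingIdeal F) :
    Tendsto (fun n => ‖T (delta n)‖) F (𝓝 0) := by
  refine Metric.tendsto_nhds.2 fun ε hε => ?_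
  obtain ⟨S, hS, h_lt⟩ := mem_vanishingIdeal_iff.1 hT ε hε
  filter_upwards [hS] with n hn
  rw [dist_zero_right, norm_norm]
  calc ‖T (delta n)‖ = ‖(T * siteProj S) (delta n)‖ := by
        rw [mul_apply_eq_comp, siteProj_delta_of_mem hn]
    _ ≤ ‖T * siteProj S‖ := by simpa [norm_delta] using (T * siteProj S).le_opNorm (delta n)
    _ < ε := h_lt

lemma mul_phaseTranslation_mem_vanishingIdeal {v : Lattice} (hF : Tendsto (· + v) F F)
    (h : Lattice → ℝ) (hT : T ∈ vanishingIdeal F) :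
    T * phaseTranslation h v ∈ vanishingIdeal F :=
  map_mem_closure (f := (· * phaseTranslation h v)) (continuous_mul_const _) hT fun S hS =>
    (hF.eventually hS).mono fun n hn => by
      rw [mul_apply_eq_comp, phaseTranslation_delta, map_smul, hn, smul_zero]

lemma tendsto_mul_siteProj_preimage_finset {α : Type*} {f : Lattice → α}
    (hT : T ∈ vanishingIdeal (comap f cofinite)) :
    Tendsto (fun K : Finset α => T * siteProj (f ⁻¹' K)) atTop (𝓝 T) := by
  classical
  refine Metric.tendsto_atTop.2 fun ε hε => ?_
  obtain ⟨S, ⟨s, hs, hsS⟩, h_lt⟩ := mem_vanishingIdeal_iff.1 hT ε hε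
  refine ⟨(mem_cofinite.1 hs).toFinset, fun K hK => lt_of_le_of_lt ?_ h_lt⟩
  have h_compl : T - T * siteProj (f ⁻¹' K) = T * siteProj (f ⁻¹' K)ᶜ := by
    rw [Set.compl_eq_univ_sdiff, siteProj_diff (Set.subset_univ _), siteProj_univ, mul_sub, mul_one]
  rw [dist_comm, dist_eq_norm, h_compl]
  refine norm_mul_siteProj_le_of_subset T fun n hn => hsS ?_
  by_contra h_notMem
  exact hn (hK ((mem_cofinite.1 hs).mem_toFinset.2 h_notMem))

end VanishingIdeal

section CompactOperators

lemma tendsto_comp_of_isCompactOperator {ι E₁ E₂ E₃ : Type*} [NormedAddCommGroup E₁]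
    [NormedSpace ℂ E₁] [NormedAddCommGroup E₂] [NormedSpace ℂ E₂] [NormedAddCommGroup E₃]
    [NormedSpace ℂ E₃] {l : Filter ι} {A : ι → E₂ →L[ℂ] E₃} {C : ℝ} (hC : ∀ i, ‖A i‖ ≤ C)
    (hA : ∀ y, Tendsto (fun i => A i y) l (𝓝 0)) {T : E₁ →L[ℂ] E₂} (hT : IsCompactOperator T) :
    Tendsto (fun i => A i ∘L T) l (𝓝 0) := by
  obtain ⟨K, hK, hTK⟩ := hT.image_closedBall_subset_compact (f := T.toLinearMap) 1
  refine Metric.tendsto_nhds.2 fun ε hε => ?_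
  obtain ⟨r, hr, hCr⟩ : ∃ r > 0, C * r ≤ ε / 3 := by
    refine ⟨ε / (3 * (|C| + 1)), by positivity, ?_⟩
    rw [mul_div_assoc', div_le_iff₀ (by positivity)]
    nlinarith [le_abs_self C]
  obtain ⟨t, -, ht, hKt⟩ := hK.finite_cover_balls hr
  have h_small : ∀ᶠ i in l, ∀ y ∈ t, ‖A i y‖ < ε / 3 := (eventually_all_finite ht).2 fun y _ => by
    simpa using (hA y).norm.eventually_lt_const (by simpa using by positivity : ‖(0 : E₃)‖ < ε / 3)
  filter_upwards [h_small] with i hi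
  rw [dist_zero_right]
  refine (ContinuousLinearMap.opNorm_le_of_unit_norm (by positivity : 0 ≤ ε / 3 + ε / 3)
    fun x hx => ?_).trans_lt (by linarith)
  have hTx : T x ∈ K := hTK ⟨x, by simp [hx], rfl⟩
  obtain ⟨y, hy, hxy⟩ := Set.mem_iUnion₂.1 (hKt hTx)
  have h_diff : ‖A i (T x - y)‖ ≤ ε / 3 := by
    rw [mem_ball_iff_norm] at hxy
    exact ((A i).le_of_opNorm_le_of_le (hC i) hxy.le).trans hCr
  calc ‖A i (T x)‖ = ‖A i (T x - y) + A i y‖ := by rw [map_sub, sub_add_cancel]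
    _ ≤ ε / 3 + ε / 3 := norm_add_le_of_le h_diff (hi y hy).le

lemma tendsto_siteProj_finset_apply (ψ : L2) :
    Tendsto (fun K : Finset Lattice => siteProj K ψ) atTop (𝓝 ψ) := by
  refine (hasSum_delta ψ).congr fun K => ?_
  rw [← Set.preimage_id (s := (K : Set Lattice)), siteProj_preimage_finset, sum_apply]
  refine Finset.sum_congr rfl fun n _ => ?_
  rw [Set.preimage_id, siteProj_singleton, InnerProductSpace.rankOne_apply, inner_delta_left]

lemma isCompactOperator_siteProj_finset (K : Finset Lattice) : IsCompactOperator (siteProj K) := by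
  rw [← Set.preimage_id (s := (K : Set Lattice)), siteProj_preimage_finset]
  refine sum_mem (S := compactOps) fun n _ => ?_
  rw [Set.preimage_id, siteProj_singleton, InnerProductSpace.rankOne_def']
  have h_inner : IsCompactOperator (innerSL ℂ (delta n)) :=
    isCompactOperator_of_locallyCompactSpace_dom _
  exact h_inner.clm_comp (.toSpanSingleton ℂ (delta n))

theorem mem_vanishingIdeal_cofinite_iff {T : BoundedOp} :
    T ∈ vanishingIdeal cofinite ↔ IsCompactOperator T := by
  refine ⟨fun hT => ?_, fun hT => ?_⟩
  · rw [← comap_id (f := cofinite)] at hT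
    exact isCompactOperator_of_tendsto (tendsto_mul_siteProj_preimage_finset hT)
      (Eventually.of_forall fun K => (isCompactOperator_siteProj_finset K).clm_comp T)
  · have h_star : Tendsto (fun K : Finset Lattice => siteProj (K : Set Lattice)ᶜ * star T)
        atTop (𝓝 0) := by
      refine tendsto_comp_of_isCompactOperator (fun K => norm_siteProj_le _) (fun ψ => ?_)
        (isCompactOperator_star hT)
      simpa [Set.compl_eq_univ_sdiff, siteProj_diff, siteProj_univ] using
        (tendsto_siteProj_finset_apply ψ).const_sub ψ
    have h_tendsto : Tendsto (fun K : Finset Lattice => T * siteProj (K : Set Lattice)ᶜ)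
        atTop (𝓝 0) := by
      simpa [star_siteProj] using h_star.star
    refine mem_vanishingIdeal_iff.2 fun ε hε => ?_
    obtain ⟨K, hK⟩ := (h_tendsto.norm.eventually_lt_const (by simpa using hε)).exists
    exact ⟨_, K.finite_toSet.compl_mem_cofinite, hK⟩

end CompactOperators

section CongruentPairs

variable (R : Type*) {A : Type*} [CommSemiring R] [Ring A] [Algebra R A]

/-- The algebra of the pairs `(x, y)` which are congruent modulo a left ideal `I` and for which
`I y ⊆ I`; the second condition makes the congruence multiplicative. -/
def congruentPairs (I : Ideal A) : Subalgebra R (A × A) where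
  carrier := {z | z.1 - z.2 ∈ I ∧ ∀ x ∈ I, x * z.2 ∈ I}
  mul_mem' {z w} hz hw := by
    refine ⟨?_, fun x hx => ?_⟩
    · have h_split : z.1 * w.1 - z.2 * w.2 = z.1 * (w.1 - w.2) + (z.1 - z.2) * w.2 := by
        noncomm_ring
      exact h_split ▸ I.add_mem (I.mul_mem_left _ hw.1) (hw.2 _ hz.1)
    · exact mul_assoc x z.2 w.2 ▸ hw.2 _ (hz.2 _ hx)
  add_mem' {z w} hz hw := by
    refine ⟨?_, fun x hx => ?_⟩
    · exact add_sub_add_comm z.1 w.1 z.2 w.2 ▸ I.add_mem hz.1 hw.1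
    · exact mul_add x z.2 w.2 ▸ I.add_mem (hz.2 _ hx) (hw.2 _ hx)
  algebraMap_mem' r := by
    refine ⟨by simp, fun x hx => ?_⟩
    exact (Algebra.commutes r x) ▸ I.mul_mem_left _ hx

lemma isClosed_congruentPairs [TopologicalSpace A] [IsTopologicalRing A] {I : Ideal A}
    (hI : IsClosed (I : Set A)) : IsClosed (congruentPairs R I : Set (A × A)) := by
  have h_mul : IsClosed {z : A × A | ∀ x ∈ I, x * z.2 ∈ I} := by
    simp only [Set.ofPred_forall]
    exact isClosed_biInter fun x _ => hI.preimage (continuous_const.mul continuous_snd)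
  exact (hI.preimage (continuous_fst.sub continuous_snd)).inter h_mul

end CongruentPairs

section AsymptoticField

variable {F F' : Filter Lattice} {B B' : Lattice → ℝ}

lemma phaseTranslation_mem_congruentPairs (hF : ∀ v, Tendsto (· + v) F F) {h h' : Lattice → ℝ}
    (hh : h =ᶠ[F] h') (v : Lattice) :
    (phaseTranslation h v, phaseTranslation h' v) ∈ congruentPairs ℂ (vanishingIdeal F) := by
  refine ⟨mem_vanishingIdeal_of_eventually ?_,
    fun T hT => mul_phaseTranslation_mem_vanishingIdeal (hF v) h' hT⟩
  filter_upwards [(hF v).eventually hh] with n hn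
  rw [sub_apply, phaseTranslation_delta, phaseTranslation_delta, hn, sub_self]

/-- The field `B` looks like `B'` along the translation invariant filter `F`: the potentials agree
near `F`, and `F` reaches copies of any site under the translational symmetries of `B'`. -/
structure IsAsymptoticField (F : Filter Lattice) (B B' : Lattice → ℝ) : Prop where
  tendsto_add (v : Lattice) : Tendsto (· + v) F F
  vectorPotential_eventuallyEq : vectorPotential B =ᶠ[F] vectorPotential B'
  frequently_periodic (n : Lattice) : ∃ᶠ m in F, Function.Periodic B' (m - n)

namespace IsAsymptoticField

variable (h : IsAsymptoticField F B B')

include h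

lemma magTranslation_mem_congruentPairs (j : Fin 2) :
    (magTranslation B j, magTranslation B' j) ∈ congruentPairs ℂ (vanishingIdeal F) :=
  phaseTranslation_mem_congruentPairs h.tendsto_add
    (h.vectorPotential_eventuallyEq.fun_comp (· j)) _

lemma star_magTranslation_mem_congruentPairs (j : Fin 2) :
    (star (magTranslation B j), star (magTranslation B' j)) ∈
      congruentPairs ℂ (vanishingIdeal F) := by
  simp only [magTranslation_eq_phaseTranslation, star_phaseTranslation]
  refine phaseTranslation_mem_congruentPairs h.tendsto_add ?_ _
  filter_upwards [(h.tendsto_add (basisVec j)).eventually h.vectorPotential_eventuallyEq] with n hn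
  rw [hn]

lemma eq_zero_of_mem_vanishingIdeal {b : magAlgebra B'} (hb : (b : BoundedOp) ∈ vanishingIdeal F) :
    b = 0 := by
  refine Subtype.ext (boundedOp_ext fun n => norm_le_zero_iff.1 (not_lt.1 fun h_pos => ?_))
  have h_lt := (tendsto_norm_apply_delta_of_mem_vanishingIdeal hb).eventually_lt_const h_pos
  obtain ⟨m, hm, hm_lt⟩ := ((h.frequently_periodic n).and_eventually h_lt).exists
  have h_eq := norm_apply_delta_add_of_periodic hm b.2 n
  rw [add_sub_cancel] at h_eq
  exact hm_lt.ne h_eq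

lemma exists_isEvaluation : ∃ ev : magAlgebra B →⋆ₐ[ℂ] magAlgebra B', IsEvaluation ev := by
  let ι := AlgHom.prodMap (magAlgebra B).subtype.toAlgHom (magAlgebra B').subtype.toAlgHom
  have h_closed : IsClosed ((congruentPairs ℂ (vanishingIdeal F)).comap ι :
      Set (magAlgebra B × magAlgebra B')) :=
    (isClosed_congruentPairs ℂ (isClosed_vanishingIdeal F)).preimage
      (continuous_subtype_val.prodMap continuous_subtype_val)
  have h_zero (b : magAlgebra B') (hb : (0, b) ∈ (congruentPairs ℂ (vanishingIdeal F)).comap ι) :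
      b = 0 := by
    have hb' : (0 - b : BoundedOp) ∈ vanishingIdeal F := hb.1
    rw [zero_sub, neg_mem_iff] at hb'
    exact h.eq_zero_of_mem_vanishingIdeal hb'
  obtain ⟨ev, hev⟩ := exists_starAlgHom_of_closed_subalgebra (topologicalClosure_adjoin_gen B)
    h_closed (y := gen B') h.magTranslation_mem_congruentPairs
    h.star_magTranslation_mem_congruentPairs h_zero
  exact ⟨ev, IsEvaluation.of_gen hev⟩

variable {ev : magAlgebra B →⋆ₐ[ℂ] magAlgebra B'} (hev : IsEvaluation ev)

include hev

lemma sub_map_mem_vanishingIdeal (a : magAlgebra B) :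
    (a - ev a : BoundedOp) ∈ vanishingIdeal F := by
  let ι : magAlgebra B →ₐ[ℂ] BoundedOp × BoundedOp :=
    (magAlgebra B).subtype.toAlgHom.prod ((magAlgebra B').subtype.comp ev).toAlgHom
  have h_closed : IsClosed ((congruentPairs ℂ (vanishingIdeal F)).comap ι : Set (magAlgebra B)) :=
    (isClosed_congruentPairs ℂ (isClosed_vanishingIdeal F)).preimage
      (continuous_subtype_val.prodMk (continuous_subtype_val.comp (map_continuous ev)))
  have h_le := topologicalClosure_adjoin_le_subalgebra (s := Set.range (gen B)) h_closed
    (Set.range_subset_iff.2 fun j => ?_) (Set.forall_mem_range.2 fun j => ?_)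
  · have ha : a ∈ (StarAlgebra.adjoin ℂ (Set.range (gen B))).topologicalClosure :=
      topologicalClosure_adjoin_gen B ▸ trivial
    exact (h_le ha).1
  · change ((gen B j : BoundedOp), (ev (gen B j) : BoundedOp)) ∈ congruentPairs ℂ _
    exact hev.2 j ▸ h.magTranslation_mem_congruentPairs j
  · change ((star (gen B j) : BoundedOp), (ev (star (gen B j)) : BoundedOp)) ∈ congruentPairs ℂ _
    rw [map_star, hev.2 j]
    exact h.star_magTranslation_mem_congruentPairs j

theorem map_eq_iff {a : magAlgebra B} {b : magAlgebra B'} :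
    ev a = b ↔ (a - b : BoundedOp) ∈ vanishingIdeal F := by
  refine ⟨fun hab => hab ▸ h.sub_map_mem_vanishingIdeal hev a, fun hab => ?_⟩
  refine sub_eq_zero.1 (h.eq_zero_of_mem_vanishingIdeal ?_)
  simpa using sub_mem hab (h.sub_map_mem_vanishingIdeal hev a)

lemma map_eq_zero_iff {a : magAlgebra B} : ev a = 0 ↔ (a : BoundedOp) ∈ vanishingIdeal F := by
  simpa using h.map_eq_iff hev (a := a) (b := 0)

variable {S : Set Lattice} (hS : siteProj S ∈ magAlgebra B)

lemma map_siteProj_eq {T : Set Lattice} (hT : siteProj T ∈ magAlgebra B')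
    (hST : ∀ᶠ n in F, n ∈ S ↔ n ∈ T) : ev ⟨siteProj S, hS⟩ = ⟨siteProj T, hT⟩ := by
  refine (h.map_eq_iff hev).2 (mem_vanishingIdeal_of_eventually (hST.mono fun n hn => ?_))
  rw [sub_apply]
  by_cases hnS : n ∈ S
  · rw [siteProj_delta_of_mem hnS, siteProj_delta_of_mem (hn.1 hnS), sub_self]
  · rw [siteProj_delta_of_notMem hnS, siteProj_delta_of_notMem (mt hn.2 hnS), sub_self]

lemma map_siteProj_eq_one (hSF : S ∈ F) : ev ⟨siteProj S, hS⟩ = 1 := by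
  rw [h.map_siteProj_eq hev hS (T := Set.univ) (siteProj_univ ▸ one_mem _)
    (by filter_upwards [hSF] with n hn using by simp [hn])]
  exact Subtype.ext siteProj_univ

lemma map_siteProj_eq_zero (hSF : Sᶜ ∈ F) : ev ⟨siteProj S, hS⟩ = 0 :=
  (h.map_eq_zero_iff hev).2 <| mem_vanishingIdeal_of_eventually <| by
    filter_upwards [hSF] with n hn using siteProj_delta_of_notMem hn

end IsAsymptoticField

lemma IsBulkEvaluation.fst {bcor bstar : ℝ} {evb : magAlgebra B →⋆ₐ[ℂ] BulkAlgebra bcor bstar}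
    (h : IsBulkEvaluation evb) : IsEvaluation ((StarAlgHom.fst ℂ _ _).comp evb) :=
  IsEvaluation.of_gen fun j => congr_arg Prod.fst (h.2 j)

lemma IsBulkEvaluation.snd {bcor bstar : ℝ} {evb : magAlgebra B →⋆ₐ[ℂ] BulkAlgebra bcor bstar}
    (h : IsBulkEvaluation evb) : IsEvaluation ((StarAlgHom.snd ℂ _ _).comp evb) :=
  IsEvaluation.of_gen fun j => congr_arg Prod.snd (h.2 j)

lemma exists_isBulkEvaluation {bcor bstar : ℝ} (h : IsAsymptoticField F B (constField bcor))
    (h' : IsAsymptoticField F' B (constField bstar)) {S : Set Lattice}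
    (hS : siteProj S ∈ magAlgebra B) (hSF : S ∈ F) (hSF' : Sᶜ ∈ F') :
    ∃ evb : magAlgebra B →⋆ₐ[ℂ] BulkAlgebra bcor bstar, IsBulkEvaluation evb := by
  obtain ⟨ev, hev⟩ := h.exists_isEvaluation
  obtain ⟨ev', hev'⟩ := h'.exists_isEvaluation
  exact ⟨ev.prod ev', prod_surjective_of_map_eq_one_of_map_eq_zero hev.1 hev'.1
    (h.map_siteProj_eq_one hev hS hSF) (h'.map_siteProj_eq_zero hev' hS hSF'),
    fun j => Prod.ext (hev.2 j) (hev'.2 j)⟩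

end AsymptoticField

section Directions

lemma tendsto_add_comap {M N : Type*} [AddMonoid M] [AddMonoid N] (f : M →+ N) {G : Filter N}
    (hG : ∀ k, Tendsto (· + k) G G) (v : M) : Tendsto (· + v) (comap f G) (comap f G) :=
  tendsto_comap_iff.2 <| by simpa [Function.comp_def] using (hG (f v)).comp tendsto_comap

lemma tendsto_add_atTop (k : ℤ) : Tendsto (· + k) atTop atTop :=
  tendsto_atTop_add_const_right _ k tendsto_id

lemma tendsto_add_atBot (k : ℤ) : Tendsto (· + k) atBot atBot :=
  tendsto_atBot_add_const_right _ k tendsto_id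

variable {G : Filter ℤ} [G.NeBot] {B B' : Lattice → ℝ}

lemma isAsymptoticField_comap_fst (hG : ∀ k, Tendsto (· + k) G G)
    (hB : ∀ᶠ l in G, ∀ m, B (l, m) = B' (l, m)) (hB' : ∀ l l' m, B' (l, m) = B' (l', m)) :
    IsAsymptoticField (comap Prod.fst G) B B' where
  tendsto_add := tendsto_add_comap (AddMonoidHom.fst ℤ ℤ) hG
  vectorPotential_eventuallyEq := by
    filter_upwards [tendsto_comap.eventually hB] with n hn
    exact vectorPotential_congr fun m _ => hn m
  frequently_periodic n := frequently_comap.2 <| Frequently.of_forall fun l =>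
    ⟨(l, n.2), rfl, fun m => by
      rw [show m + ((l, n.2) - n) = (m.1 + (l - n.1), m.2) from Prod.ext rfl (by simp)]
      exact hB' _ _ _⟩

lemma isAsymptoticField_comap_snd (hG : ∀ k, Tendsto (· + k) G G)
    (hB : ∀ᶠ k in G, ∀ m ∈ Set.uIoc 0 k, ∀ l, B (l, m) = B' (l, m))
    (hB' : ∀ l m m', B' (l, m) = B' (l, m')) : IsAsymptoticField (comap Prod.snd G) B B' where
  tendsto_add := tendsto_add_comap (AddMonoidHom.snd ℤ ℤ) hG
  vectorPotential_eventuallyEq := by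
    filter_upwards [tendsto_comap.eventually hB] with n hn
    exact vectorPotential_congr fun m hm => hn m hm n.1
  frequently_periodic n := frequently_comap.2 <| Frequently.of_forall fun k =>
    ⟨(n.1, k), rfl, fun m => by
      rw [show m + ((n.1, k) - n) = (m.1, m.2 + (k - n.2)) from Prod.ext (by simp) rfl]
      exact hB' _ _ _⟩

variable (bcor bstar : ℝ)

lemma isAsymptoticField_quarterField_upField :
    IsAsymptoticField (comap Prod.snd atTop) (quarterField bcor bstar) (upField bcor bstar) := by
  refine isAsymptoticField_comap_snd tendsto_add_atTop ?_ fun _ _ _ => rfl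
  filter_upwards [eventually_ge_atTop 0] with k hk m hm l
  rw [Set.uIoc_of_le hk] at hm
  simp [quarterField, upField, hm.1.not_ge]

lemma isAsymptoticField_quarterField_rightField :
    IsAsymptoticField (comap Prod.fst atTop) (quarterField bcor bstar) (rightField bcor bstar) := by
  refine isAsymptoticField_comap_fst tendsto_add_atTop ?_ fun _ _ _ => rfl
  filter_upwards [eventually_gt_atTop 0] with l hl m
  simp [quarterField, rightField, hl.not_ge]

lemma isAsymptoticField_quarterField_left :
    IsAsymptoticField (comap Prod.fst atBot) (quarterField bcor bstar) (constField bstar) := by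
  refine isAsymptoticField_comap_fst tendsto_add_atBot ?_ fun _ _ _ => rfl
  filter_upwards [eventually_le_atBot 0] with l hl m
  simp [quarterField, constField, hl]

lemma isAsymptoticField_quarterField_down :
    IsAsymptoticField (comap Prod.snd atBot) (quarterField bcor bstar) (constField bstar) := by
  refine isAsymptoticField_comap_snd tendsto_add_atBot ?_ fun _ _ _ => rfl
  filter_upwards [eventually_le_atBot 0] with k hk m hm l
  rw [Set.uIoc_of_ge hk] at hm
  simp [quarterField, constField, hm.2]

lemma isAsymptoticField_upField_right :
    IsAsymptoticField (comap Prod.fst atTop) (upField bcor bstar) (constField bcor) := by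
  refine isAsymptoticField_comap_fst tendsto_add_atTop ?_ fun _ _ _ => rfl
  filter_upwards [eventually_gt_atTop 0] with l hl m
  simp [upField, constField, hl]

lemma isAsymptoticField_upField_left :
    IsAsymptoticField (comap Prod.fst atBot) (upField bcor bstar) (constField bstar) := by
  refine isAsymptoticField_comap_fst tendsto_add_atBot ?_ fun _ _ _ => rfl
  filter_upwards [eventually_le_atBot 0] with l hl m
  simp [upField, constField, hl]

lemma isAsymptoticField_rightField_up :
    IsAsymptoticField (comap Prod.snd atTop) (rightField bcor bstar) (constField bcor) := by
  refine isAsymptoticField_comap_snd tendsto_add_atTop ?_ fun _ _ _ => rfl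
  filter_upwards [eventually_ge_atTop 0] with k hk m hm l
  rw [Set.uIoc_of_le hk] at hm
  simp [rightField, constField, hm.1]

lemma isAsymptoticField_rightField_down :
    IsAsymptoticField (comap Prod.snd atBot) (rightField bcor bstar) (constField bstar) := by
  refine isAsymptoticField_comap_snd tendsto_add_atBot ?_ fun _ _ _ => rfl
  filter_upwards [eventually_le_atBot 0] with k hk m hm l
  rw [Set.uIoc_of_ge hk] at hm
  simp [rightField, constField, hm.2]

lemma isCompactOperator_iff_mem_vanishingIdeal {T : BoundedOp} :
    IsCompactOperator T ↔
      (T ∈ vanishingIdeal (comap Prod.fst atBot) ∧ T ∈ vanishingIdeal (comap Prod.fst atTop)) ∧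
        T ∈ vanishingIdeal (comap Prod.snd atBot) ∧ T ∈ vanishingIdeal (comap Prod.snd atTop) := by
  rw [← mem_vanishingIdeal_cofinite_iff, ← coprod_cofinite, Filter.coprod, Int.cofinite_eq,
    comap_sup, comap_sup]
  simp only [vanishingIdeal_sup, Submodule.mem_inf]

end Directions

section SiteProjections

variable {B : Lattice → ℝ} {bcor bstar : ℝ}

lemma phaseTranslation_field_mem_magAlgebra (B : Lattice → ℝ) :
    phaseTranslation B 0 ∈ magAlgebra B := by
  have h_comm : magTranslation B 0 * magTranslation B 1
      = phaseTranslation B 0 * (magTranslation B 1 * magTranslation B 0) := by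
    simp only [magTranslation_eq_phaseTranslation, phaseTranslation_mul, zero_add,
      add_comm (basisVec 1)]
    congr 1
    funext n
    have h_circ := vectorPotential_sub B n.1 n.2
    have h_sub : n - 0 - basisVec 1 = (n.1, n.2 - 1) := by simp [Prod.ext_iff, basisVec]
    simp only [vectorPotential_one, h_sub]
    linarith
  have h_mem (j : Fin 2) : magTranslation B j ∈ magAlgebra B := magTranslation_mem B j
  have hu : magTranslation B 1 * magTranslation B 0 ∈ unitary BoundedOp :=
    mul_mem (phaseTranslation_mem_unitary _ _) (phaseTranslation_mem_unitary _ _)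
  have h_eq : phaseTranslation B 0 = magTranslation B 0 * magTranslation B 1
      * star (magTranslation B 1 * magTranslation B 0) := by
    rw [h_comm, mul_assoc, Unitary.mul_star_self_of_mem hu, mul_one]
  exact h_eq ▸ mul_mem (mul_mem (h_mem 0) (h_mem 1)) (star_mem (mul_mem (h_mem 1) (h_mem 0)))

lemma siteProj_mem_magAlgebra_of_field {S : Set Lattice} {c d : ℝ}
    (hcd : Complex.exp (Complex.I * c) ≠ Complex.exp (Complex.I * d)) (hc : ∀ n ∈ S, B n = c)
    (hd : ∀ n ∉ S, B n = d) : siteProj S ∈ magAlgebra B := by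
  have h_eq : siteProj S = (Complex.exp (Complex.I * c) - Complex.exp (Complex.I * d))⁻¹ •
      (phaseTranslation B 0 - Complex.exp (Complex.I * d) • 1) := by
    refine boundedOp_ext fun n => ?_
    simp only [smul_apply, sub_apply, one_apply_eq_self, phaseTranslation_delta, add_zero,
      ← sub_smul]
    by_cases hn : n ∈ S
    · rw [siteProj_delta_of_mem hn, hc n hn, smul_smul, inv_mul_cancel₀ (sub_ne_zero.2 hcd),
        one_smul]
    · rw [siteProj_delta_of_notMem hn, hd n hn, sub_self, zero_smul, smul_zero]
  exact h_eq ▸ SMulMemClass.smul_mem _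
    (sub_mem (phaseTranslation_field_mem_magAlgebra B) (SMulMemClass.smul_mem _ (one_mem _)))

lemma siteProj_diff_mem_magAlgebra {S T : Set Lattice} (h : T ⊆ S) (hS : siteProj S ∈ magAlgebra B)
    (hT : siteProj T ∈ magAlgebra B) : siteProj (S \ T) ∈ magAlgebra B :=
  siteProj_diff h ▸ sub_mem hS hT

variable (hb : Complex.exp (Complex.I * bcor) ≠ Complex.exp (Complex.I * bstar))

include hb

lemma siteProj_rightHalfPlane_mem : siteProj (Prod.fst ⁻¹' Set.Ioi 0) ∈ upAlgebra bcor bstar :=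
  siteProj_mem_magAlgebra_of_field hb (fun _ hn => if_neg (not_le.2 hn))
    fun _ hn => if_pos (not_lt.1 hn)

lemma siteProj_upperHalfPlane_mem : siteProj (Prod.snd ⁻¹' Set.Ioi 0) ∈ rightAlgebra bcor bstar :=
  siteProj_mem_magAlgebra_of_field hb (fun _ hn => if_neg (not_le.2 hn))
    fun _ hn => if_pos (not_lt.1 hn)

lemma siteProj_row_mem (k : ℤ) : siteProj (Prod.snd ⁻¹' {k}) ∈ rightAlgebra bcor bstar := by
  have h_half (a : ℤ) : siteProj (Prod.snd ⁻¹' Set.Ioi a) ∈ rightAlgebra bcor bstar := by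
    convert siteProj_image_add_right_mem_magAlgebra (siteProj_upperHalfPlane_mem hb) (0, a) using 2
    ext n
    simp
  convert siteProj_diff_mem_magAlgebra (fun n hn => ?_) (h_half (k - 1)) (h_half k) using 2
  · ext n
    simp only [Set.mem_preimage, Set.mem_singleton_iff, Set.mem_sdiff, Set.mem_Ioi]
    lia
  · simp only [Set.mem_preimage, Set.mem_Ioi] at hn ⊢
    lia

lemma siteProj_quadrant_mem (a b : ℤ) :
    siteProj (Set.Ici a ×ˢ Set.Ici b) ∈ quarterAlgebra bcor bstar := by
  have h_quarter : siteProj (Set.Ioi 0 ×ˢ Set.Ioi 0) ∈ quarterAlgebra bcor bstar := by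
    refine siteProj_mem_magAlgebra_of_field hb (fun n hn => if_neg ?_) fun n hn => if_pos ?_
    · rw [Set.mem_prod, Set.mem_Ioi, Set.mem_Ioi] at hn
      lia
    · rw [Set.mem_prod, Set.mem_Ioi, Set.mem_Ioi] at hn
      lia
  convert siteProj_image_add_right_mem_magAlgebra h_quarter (a - 1, b - 1) using 2
  ext n
  simp only [Set.image_add_right, Set.mem_preimage, Set.mem_prod, Set.mem_Ici, Set.mem_Ioi,
    Prod.fst_add, Prod.snd_add, Prod.neg_mk]
  lia

lemma siteProj_halfRow_mem (a b : ℤ) :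
    siteProj (Set.Ici a ×ˢ {b}) ∈ quarterAlgebra bcor bstar := by
  convert siteProj_diff_mem_magAlgebra (Set.prod_mono_right (Set.Ici_subset_Ici.2 (by lia)))
    (siteProj_quadrant_mem hb a b) (siteProj_quadrant_mem hb a (b + 1)) using 2
  ext n
  simp only [Set.mem_prod, Set.mem_Ici, Set.mem_singleton_iff, Set.mem_sdiff]
  lia

lemma siteProj_halfColumn_mem (a b : ℤ) :
    siteProj ({a} ×ˢ Set.Ici b) ∈ quarterAlgebra bcor bstar := by
  convert siteProj_diff_mem_magAlgebra (Set.prod_mono_left (Set.Ici_subset_Ici.2 (by lia)))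
    (siteProj_quadrant_mem hb a b) (siteProj_quadrant_mem hb (a + 1) b) using 2
  ext n
  simp only [Set.mem_prod, Set.mem_Ici, Set.mem_singleton_iff, Set.mem_sdiff]
  lia

lemma siteProj_origin_mem : siteProj {0} ∈ quarterAlgebra bcor bstar := by
  convert siteProj_diff_mem_magAlgebra (Set.prod_mono_left (Set.Ici_subset_Ici.2 zero_le_one))
    (siteProj_halfRow_mem hb 0 0) (siteProj_halfRow_mem hb 1 0) using 2
  ext n
  simp only [Set.mem_sdiff, Set.mem_prod, Set.mem_Ici, Set.mem_singleton_iff, Prod.ext_iff,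
    Prod.fst_zero, Prod.snd_zero]
  lia

end SiteProjections

section CompactsInMagneticAlgebra

variable {B : Lattice → ℝ}

lemma rankOne_delta_mem_magAlgebra (h_origin : siteProj {0} ∈ magAlgebra B) (n k : Lattice) :
    InnerProductSpace.rankOne ℂ (delta n) (delta k) ∈ magAlgebra B := by
  obtain ⟨h, hh⟩ := exists_phaseTranslation_mem_magAlgebra B (n - k)
  have h_site : siteProj {k} ∈ magAlgebra B := by
    simpa using siteProj_image_add_right_mem_magAlgebra h_origin k
  have h_eq : phaseTranslation h (n - k) * siteProj {k}
      = Complex.exp (Complex.I * h n) • InnerProductSpace.rankOne ℂ (delta n) (delta k) := by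
    rw [siteProj_singleton, ContinuousLinearMap.mul_def, InnerProductSpace.comp_rankOne,
      phaseTranslation_delta, add_sub_cancel, map_smul]
    rfl
  rw [← inv_smul_smul₀ (Complex.exp_ne_zero (Complex.I * h n))
    (InnerProductSpace.rankOne ℂ (delta n) (delta k)), ← h_eq]
  exact SMulMemClass.smul_mem _ (mul_mem hh h_site)

lemma mul_siteProj_singleton_mem_magAlgebra (h_origin : siteProj {0} ∈ magAlgebra B)
    (T : BoundedOp) (k : Lattice) : T * siteProj {k} ∈ magAlgebra B := by
  rw [siteProj_singleton, ContinuousLinearMap.mul_def, InnerProductSpace.comp_rankOne]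
  have h_sum : HasSum (fun n => T (delta k) n • InnerProductSpace.rankOne ℂ (delta n) (delta k))
      (InnerProductSpace.rankOne ℂ (T (delta k)) (delta k)) := by
    simpa using (hasSum_delta (T (delta k))).mapL
      ((InnerProductSpace.rankOne ℂ (E := L2) (F := L2)).flip (delta k))
  exact (isClosed_magAlgebra B).mem_of_tendsto h_sum <| Eventually.of_forall fun K =>
    sum_mem fun n _ => SMulMemClass.smul_mem _ (rankOne_delta_mem_magAlgebra h_origin n k)

theorem mem_magAlgebra_of_isCompactOperator (h_origin : siteProj {0} ∈ magAlgebra B)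
    {T : BoundedOp} (hT : IsCompactOperator T) : T ∈ magAlgebra B := by
  rw [← mem_vanishingIdeal_cofinite_iff, ← comap_id (f := cofinite)] at hT
  refine (isClosed_magAlgebra B).mem_of_tendsto (tendsto_mul_siteProj_preimage_finset hT)
    (Eventually.of_forall fun K => ?_)
  rw [siteProj_preimage_finset, Finset.mul_sum]
  exact sum_mem fun n _ => mul_siteProj_singleton_mem_magAlgebra h_origin T n

theorem mem_closedIdeal_of_isCompactOperator {S : Set Lattice} (hS : siteProj S ∈ magAlgebra B)
    (h_origin : siteProj {0} ∈ magAlgebra B) (h0 : 0 ∈ S) {a : magAlgebra B}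
    (ha : IsCompactOperator (a : BoundedOp)) :
    a ∈ closedIdeal (⟨siteProj S, hS⟩ : magAlgebra B) := by
  set J := TwoSidedIdeal.span {(⟨siteProj S, hS⟩ : magAlgebra B)}
  have h_site (n : Lattice) : ∃ p ∈ J, (p : BoundedOp) = siteProj {n} := by
    obtain ⟨h, hh⟩ := exists_phaseTranslation_mem_magAlgebra B n
    refine ⟨⟨_, hh⟩ * (⟨_, h_origin⟩ * ⟨_, hS⟩) * ⟨_, star_mem hh⟩, J.mul_mem_right _ _
      (J.mul_mem_left _ _ (J.mul_mem_left _ _ (TwoSidedIdeal.subset_span rfl))), ?_⟩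
    change phaseTranslation h n * (siteProj {0} * siteProj S) * star (phaseTranslation h n) = _
    rw [siteProj_mul, Set.inter_eq_left.2 (Set.singleton_subset_iff.2 h0),
      phaseTranslation_mul_siteProj_mul_star, Set.image_singleton, zero_add]
  choose p hpJ hp using h_site
  rw [← mem_vanishingIdeal_cofinite_iff, ← comap_id (f := cofinite)] at ha
  have h_tendsto : Tendsto (fun K : Finset Lattice => a * ∑ n ∈ K, p n) atTop (𝓝 a) := by
    refine tendsto_subtype_rng.2 ((tendsto_mul_siteProj_preimage_finset ha).congr fun K => ?_)
    rw [siteProj_preimage_finset]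
    simp [hp]
  exact mem_closure_of_tendsto h_tendsto <| Eventually.of_forall fun K =>
    J.mul_mem_left _ _ (sum_mem fun n _ => hpJ n)

end CompactsInMagneticAlgebra

section ExactSequence

lemma exp_I_mul_ne_of_sub_ne {b b' : ℝ} (hb : ∀ k : ℤ, b - b' ≠ 2 * Real.pi * k) :
    Complex.exp (Complex.I * b) ≠ Complex.exp (Complex.I * b') := fun h_eq => by
  obtain ⟨k, hk⟩ := Complex.exp_eq_exp_iff_exists_int.1 h_eq
  refine hb k (Complex.ofReal_injective (mul_left_cancel₀ Complex.I_ne_zero ?_))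
  push_cast
  linear_combination hk

/-- The inclusion of the compact operators into a magnetic algebra which contains the projection
onto the span of `δ_0`. -/
def compactInclusion {B : Lattice → ℝ} (h_origin : siteProj {0} ∈ magAlgebra B) :
    compactOps →⋆ₙₐ[ℂ] magAlgebra B where
  toFun T := ⟨T, mem_magAlgebra_of_isCompactOperator h_origin T.2⟩
  map_smul' _ _ := rfl
  map_zero' := rfl
  map_add' _ _ := rfl
  map_mul' _ _ := rfl
  map_star' _ := rfl

lemma compactInclusion_injective {B : Lattice → ℝ} (h_origin : siteProj {0} ∈ magAlgebra B) :
    Function.Injective (compactInclusion h_origin) := fun _ _ h =>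
  Subtype.ext (Subtype.ext_iff.1 h :)

lemma mem_range_compactInclusion_iff {B : Lattice → ℝ} (h_origin : siteProj {0} ∈ magAlgebra B)
    {a : magAlgebra B} :
    a ∈ Set.range (compactInclusion h_origin) ↔ IsCompactOperator (a : BoundedOp) :=
  ⟨fun ⟨T, hT⟩ => hT ▸ T.2, fun ha => ⟨⟨a, ha⟩, rfl⟩⟩

lemma rightProj_eq_siteProj : rightProj = siteProj (Set.Ici 0 ×ˢ {0}) := by
  refine congr_arg siteProj (Set.ext fun n => ⟨?_, fun hn => ?_⟩)
  · rintro ⟨j, rfl⟩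
    exact ⟨Int.natCast_nonneg j, rfl⟩
  · exact ⟨n.1.toNat, Prod.ext (Int.toNat_of_nonneg hn.1) hn.2.symm⟩

lemma upProj_eq_siteProj : upProj = siteProj ({0} ×ˢ Set.Ici 0) := by
  refine congr_arg siteProj (Set.ext fun n => ⟨?_, fun hn => ?_⟩)
  · rintro ⟨j, rfl⟩
    exact ⟨rfl, Int.natCast_nonneg j⟩
  · exact ⟨n.2.toNat, Prod.ext hn.1.symm (Int.toNat_of_nonneg hn.2)⟩

variable {bcor bstar : ℝ} {evU : quarterAlgebra bcor bstar →⋆ₐ[ℂ] upAlgebra bcor bstar}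
  {evR : quarterAlgebra bcor bstar →⋆ₐ[ℂ] rightAlgebra bcor bstar}
  (hU : IsEvaluation evU) (hR : IsEvaluation evR)

include hU in
lemma map_halfRow_eq_zero {a k : ℤ} (h : siteProj (Set.Ici a ×ˢ {k}) ∈ quarterAlgebra bcor bstar) :
    evU ⟨_, h⟩ = 0 := by
  refine (isAsymptoticField_quarterField_upField bcor bstar).map_siteProj_eq_zero hU h ?_
  filter_upwards [tendsto_comap.eventually (eventually_gt_atTop k)] with n hn h_mem
  exact hn.ne' h_mem.2

include hR in
lemma map_halfColumn_eq_zero {k b : ℤ}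
    (h : siteProj ({k} ×ˢ Set.Ici b) ∈ quarterAlgebra bcor bstar) : evR ⟨_, h⟩ = 0 := by
  refine (isAsymptoticField_quarterField_rightField bcor bstar).map_siteProj_eq_zero hR h ?_
  filter_upwards [tendsto_comap.eventually (eventually_gt_atTop k)] with n hn h_mem
  exact hn.ne' h_mem.1

include hR in
lemma map_halfRow_eq_row {a k : ℤ} (h : siteProj (Set.Ici a ×ˢ {k}) ∈ quarterAlgebra bcor bstar)
    (h' : siteProj (Prod.snd ⁻¹' {k}) ∈ rightAlgebra bcor bstar) : evR ⟨_, h⟩ = ⟨_, h'⟩ := by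
  refine (isAsymptoticField_quarterField_rightField bcor bstar).map_siteProj_eq hR h h' ?_
  filter_upwards [tendsto_comap.eventually (eventually_ge_atTop a)] with n hn
  exact ⟨fun h_mem => h_mem.2, fun h_mem => ⟨hn, h_mem⟩⟩

/- The far left and the far bottom are already seen by `ev_U` and `ev_R`. -/
include hU hR in
theorem isCompactOperator_iff_map_eq_zero {a : quarterAlgebra bcor bstar} :
    IsCompactOperator (a : BoundedOp) ↔ evU a = 0 ∧ evR a = 0 := by
  have hU_iff := (isAsymptoticField_quarterField_upField bcor bstar).map_eq_zero_iff hU (a := a)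
  have hR_iff := (isAsymptoticField_quarterField_rightField bcor bstar).map_eq_zero_iff hR (a := a)
  rw [isCompactOperator_iff_mem_vanishingIdeal]
  refine ⟨fun h => ⟨hU_iff.2 h.2.2, hR_iff.2 h.1.2⟩,
    fun h => ⟨⟨?_, hR_iff.1 h.2⟩, ?_, hU_iff.1 h.1⟩⟩
  · obtain ⟨ev, hev⟩ := (isAsymptoticField_upField_left bcor bstar).exists_isEvaluation
    refine ((isAsymptoticField_quarterField_left bcor bstar).map_eq_zero_iff (hU.comp hev)).1 ?_
    rw [StarAlgHom.comp_apply, h.1, map_zero]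
  · obtain ⟨ev, hev⟩ := (isAsymptoticField_rightField_down bcor bstar).exists_isEvaluation
    refine ((isAsymptoticField_quarterField_down bcor bstar).map_eq_zero_iff (hR.comp hev)).1 ?_
    rw [StarAlgHom.comp_apply, h.2, map_zero]

include hU hR in
theorem isCompactOperator_iff_mem_closedIdeal_inter
    (hb : Complex.exp (Complex.I * bcor) ≠ Complex.exp (Complex.I * bstar))
    (hr : rightProj ∈ quarterAlgebra bcor bstar) (hu : upProj ∈ quarterAlgebra bcor bstar)
    {a : quarterAlgebra bcor bstar} : IsCompactOperator (a : BoundedOp) ↔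
      a ∈ closedIdeal (⟨rightProj, hr⟩ : quarterAlgebra bcor bstar) ∩ closedIdeal ⟨upProj, hu⟩ := by
  have h_origin := siteProj_origin_mem hb
  refine ⟨fun ha => ⟨mem_closedIdeal_of_isCompactOperator hr h_origin ⟨0, rfl⟩ ha,
    mem_closedIdeal_of_isCompactOperator hu h_origin ⟨0, rfl⟩ ha⟩, fun ha => ?_⟩
  simp only [rightProj_eq_siteProj, upProj_eq_siteProj] at ha hr hu
  exact (isCompactOperator_iff_map_eq_zero hU hR).2
    ⟨map_eq_zero_of_mem_closedIdeal (map_continuous evU) (map_halfRow_eq_zero hU hr) ha.1,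
      map_eq_zero_of_mem_closedIdeal (map_continuous evR) (map_halfColumn_eq_zero hR hu) ha.2⟩

variable {evUb : upAlgebra bcor bstar →⋆ₐ[ℂ] BulkAlgebra bcor bstar}
  {evRb : rightAlgebra bcor bstar →⋆ₐ[ℂ] BulkAlgebra bcor bstar}
  (hUb : IsBulkEvaluation evUb) (hRb : IsBulkEvaluation evRb)

lemma exists_isBulkEvaluation_upField
    (hb : Complex.exp (Complex.I * bcor) ≠ Complex.exp (Complex.I * bstar)) :
    ∃ evUb : upAlgebra bcor bstar →⋆ₐ[ℂ] BulkAlgebra bcor bstar, IsBulkEvaluation evUb :=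
  exists_isBulkEvaluation (isAsymptoticField_upField_right bcor bstar)
    (isAsymptoticField_upField_left bcor bstar) (siteProj_rightHalfPlane_mem hb)
    (preimage_mem_comap (Ioi_mem_atTop 0))
    (tendsto_comap.eventually ((eventually_le_atBot 0).mono fun _ => not_lt.2))

lemma exists_isBulkEvaluation_rightField
    (hb : Complex.exp (Complex.I * bcor) ≠ Complex.exp (Complex.I * bstar)) :
    ∃ evRb : rightAlgebra bcor bstar →⋆ₐ[ℂ] BulkAlgebra bcor bstar, IsBulkEvaluation evRb :=
  exists_isBulkEvaluation (isAsymptoticField_rightField_up bcor bstar)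
    (isAsymptoticField_rightField_down bcor bstar) (siteProj_upperHalfPlane_mem hb)
    (preimage_mem_comap (Ioi_mem_atTop 0))
    (tendsto_comap.eventually ((eventually_le_atBot 0).mono fun _ => not_lt.2))

/-- The homomorphism `γ(a) = (ev_U(a), ev_R(a))` into the pullback algebra. -/
def asymptoticMap : quarterAlgebra bcor bstar →⋆ₐ[ℂ] asymptoticAlgebra evUb evRb :=
  (evU.prod evR).codRestrict _ fun a => DFunLike.congr_fun (bulkEvaluation_comp_eq hU hR hUb hRb) a

lemma asymptoticMap_eq_iff {a : quarterAlgebra bcor bstar} {z : asymptoticAlgebra evUb evRb} :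
    asymptoticMap hU hR hUb hRb a = z ↔ evU a = z.1.1 ∧ evR a = z.1.2 :=
  Subtype.ext_iff.trans Prod.ext_iff

include hRb in
lemma mem_vanishingIdeal_of_bulkEvaluation_eq_zero {r : rightAlgebra bcor bstar}
    (hr : evRb r = 0) : (r : BoundedOp) ∈ vanishingIdeal (comap Prod.snd cofinite) := by
  rw [Int.cofinite_eq, comap_sup, vanishingIdeal_sup]
  exact ⟨((isAsymptoticField_rightField_down bcor bstar).map_eq_zero_iff hRb.snd).1
      (congr_arg Prod.snd hr),
    ((isAsymptoticField_rightField_up bcor bstar).map_eq_zero_iff hRb.fst).1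
      (congr_arg Prod.fst hr)⟩

include hU hR hRb in
lemma exists_map_eq_zero_and_map_eq
    (hb : Complex.exp (Complex.I * bcor) ≠ Complex.exp (Complex.I * bstar))
    {r : rightAlgebra bcor bstar} (hr : evRb r = 0) : ∃ a, evU a = 0 ∧ evR a = r := by
  let row (k : ℤ) : rightAlgebra bcor bstar := ⟨_, siteProj_row_mem hb k⟩
  have h_row (k : ℤ) : (0, r * row k) ∈ (evU.prod evR).range := by
    obtain ⟨a, rfl⟩ := hR.1 r
    have h_half := siteProj_halfRow_mem hb 0 k
    refine ⟨a * ⟨_, h_half⟩, Prod.ext ?_ ?_⟩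
    · exact (map_mul evU _ _).trans (by rw [map_halfRow_eq_zero hU h_half, mul_zero])
    · exact (map_mul evR _ _).trans (by rw [map_halfRow_eq_row hR h_half (siteProj_row_mem hb k)])
  have h_tendsto : Tendsto (fun K : Finset ℤ => ∑ k ∈ K, (0, r * row k)) atTop
      (𝓝 ((0, r) : upAlgebra bcor bstar × rightAlgebra bcor bstar)) := by
    have h_right : Tendsto (fun K : Finset ℤ => ∑ k ∈ K, r * row k) atTop (𝓝 r) := by
      refine tendsto_subtype_rng.2 ((tendsto_mul_siteProj_preimage_finset
        (mem_vanishingIdeal_of_bulkEvaluation_eq_zero hRb hr)).congr fun K => ?_)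
      rw [siteProj_preimage_finset, Finset.mul_sum]
      simp [row]
    refine (tendsto_const_nhds.prodMk_nhds h_right).congr fun K => ?_
    simp [Prod.ext_iff, Prod.fst_sum, Prod.snd_sum]
  obtain ⟨a, ha⟩ := (isClosed_range_starAlgHom (evU.prod evR)).mem_of_tendsto h_tendsto <|
    Eventually.of_forall fun K => (evU.prod evR).range.sum_mem fun k _ => h_row k
  exact ⟨a, Prod.ext_iff.1 ha⟩

theorem asymptoticMap_surjective
    (hb : Complex.exp (Complex.I * bcor) ≠ Complex.exp (Complex.I * bstar)) :
    Function.Surjective (asymptoticMap hU hR hUb hRb) := by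
  rintro ⟨⟨u, r⟩, hur⟩
  obtain ⟨a, rfl⟩ := hU.1 u
  have h_bulk : evUb (evU a) = evRb (evR a) :=
    DFunLike.congr_fun (bulkEvaluation_comp_eq hU hR hUb hRb) a
  have h_diff : evRb (r - evR a) = 0 := by
    rw [map_sub, ← h_bulk, sub_eq_zero]
    exact hur.symm
  obtain ⟨b, hbU, hbR⟩ := exists_map_eq_zero_and_map_eq hU hR hRb hb h_diff
  refine ⟨a + b, (asymptoticMap_eq_iff hU hR hUb hRb).2 ⟨?_, ?_⟩⟩
  · rw [map_add, hbU, add_zero]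
  · rw [map_add, hbR, add_sub_cancel]

theorem exact_compactInclusion_asymptoticMap
    (h_origin : siteProj {0} ∈ quarterAlgebra bcor bstar) :
    Function.Exact (compactInclusion h_origin) (asymptoticMap hU hR hUb hRb) := fun a => by
  rw [mem_range_compactInclusion_iff, isCompactOperator_iff_map_eq_zero hU hR]
  exact asymptoticMap_eq_iff hU hR hUb hRb

end ExactSequence

end

end MagneticQuarterPlane

theorem mainTheorem4 (bcor bstar : ℝ) (hb : ∀ k : ℤ, bcor - bstar ≠ 2 * Real.pi * k) :
    ∃ (evU : quarterAlgebra bcor bstar →⋆ₐ[ℂ] upAlgebra bcor bstar)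
      (evR : quarterAlgebra bcor bstar →⋆ₐ[ℂ] rightAlgebra bcor bstar)
      (evUb : upAlgebra bcor bstar →⋆ₐ[ℂ] BulkAlgebra bcor bstar)
      (evRb : rightAlgebra bcor bstar →⋆ₐ[ℂ] BulkAlgebra bcor bstar),
      IsEvaluation evU ∧ IsEvaluation evR ∧ IsBulkEvaluation evUb ∧ IsBulkEvaluation evRb ∧
      ∃ (i : compactOps →⋆ₙₐ[ℂ] quarterAlgebra bcor bstar)
        (γ : quarterAlgebra bcor bstar →⋆ₐ[ℂ] asymptoticAlgebra evUb evRb),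
        (∀ k, (i k : BoundedOp) = k) ∧
        (∀ a, (γ a : upAlgebra bcor bstar × rightAlgebra bcor bstar) = (evU a, evR a)) ∧
        Function.Injective i ∧ Function.Exact i γ ∧ Function.Surjective γ ∧
        ∃ (hr : rightProj ∈ quarterAlgebra bcor bstar) (hu : upProj ∈ quarterAlgebra bcor bstar),
          Set.range i =
            closedIdeal (⟨rightProj, hr⟩ : quarterAlgebra bcor bstar) ∩
              closedIdeal (⟨upProj, hu⟩ : quarterAlgebra bcor bstar) := by
  have hb' := exp_I_mul_ne_of_sub_ne hb
  have h_origin := siteProj_origin_mem hb'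
  choose evU hU using (isAsymptoticField_quarterField_upField bcor bstar).exists_isEvaluation
  choose evR hR using (isAsymptoticField_quarterField_rightField bcor bstar).exists_isEvaluation
  choose evUb hUb using exists_isBulkEvaluation_upField hb'
  choose evRb hRb using exists_isBulkEvaluation_rightField hb'
  have hr : rightProj ∈ quarterAlgebra bcor bstar :=
    rightProj_eq_siteProj ▸ siteProj_halfRow_mem hb' 0 0
  have hu : upProj ∈ quarterAlgebra bcor bstar :=
    upProj_eq_siteProj ▸ siteProj_halfColumn_mem hb' 0 0
  refine ⟨evU, evR, evUb, evRb, hU, hR, hUb, hRb, compactInclusion h_origin,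
    asymptoticMap hU hR hUb hRb, fun _ => rfl, fun _ => rfl, compactInclusion_injective h_origin,
    exact_compactInclusion_asymptoticMap hU hR hUb hRb h_origin,
    asymptoticMap_surjective hU hR hUb hRb hb', hr, hu, Set.ext fun a => ?_⟩
  exact (mem_range_compactInclusion_iff h_origin).trans
    (isCompactOperator_iff_mem_closedIdeal_inter hU hR hb' hr hu)
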